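/- For $m\in(0,1)\cup(1,+\infty)$ let $$g_2(p,m)=m\,p\cos\left(\tfrac pm\right)\sin p-\bigl(p\cos p+(m^2-1)\sin p\bigr)\sin\left(\tfrac pm\right).$$ For every $k\in\mathbb N=\{1,2,\dots\}$ put $$c_{1,k}=\frac{1+2k}{3+2k},\quad a_{1,k}=c_{1,k}-\frac{2}{15+40k+32k^2+8k^3},\quad c_{2,k}=\frac{3+2k}{1+2k},\quad a_{2,k}=c_{2,k}+\frac{2}{1+8k(1+k^2)}.$$ **Theorem.** For every $m\in(0,1)\cup(1,+\infty)$ the function $p\mapsto g_2(p,m)$ has a minimal positive root $p_2(m)$; it satisfies $p_2(m)=m\,p_2(1/m)$, and the following properties hold. (a) The function $p_2$ is continuous on $(0,1)$ and on $(1,+\infty)$. For every $k\in\mathbb N$, $p_2(m)=\frac{\pi m}{1-m}$ at $m=\frac{k}{k+1}$ and at some point $m=m^*_{1,k}$ with $a_{1,k}<m^*_{1,k}<c_{1,k}$, and $p_2(m)=\frac{\pi m}{m-1}$ at $m=\frac{k+1}{k}$ and at some point $m=m^*_{2,k}$ with $c_{2,k}<m^*_{2,k}<a_{2,k}$. (b)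 The function $p_2$ is continuously differentiable at all points of $(0,\frac12)\cup(2,+\infty)$ and, for every $k\in\mathbb N$, at all points of $$\left[\tfrac{k}{1+k},a_{1,k}\right]\cup\left[c_{1,k},\tfrac{1+k}{2+k}\right]\cup\left[\tfrac{k+2}{k+1},c_{2,k}\right]\cup\left[a_{2,k},\tfrac{k+1}{k}\right].$$ For every $k\in\mathbb N$ there exist points $\bar m_{1,k}$ and $\bar m_{2,k}$ with $a_{1,k}<m^*_{1,k}<\bar m_{1,k}<c_{1,k}$ and $c_{2,k}<\bar m_{2,k}<m^*_{2,k}<a_{2,k}$ (where the $m^*_{i,k}$ are points as in (a)) at which the derivative of $p_2$ equals $+\infty$ and $-\infty$, respectively. (c) The following bounds hold: $$5.7\,m<p_2(m)<2\pi m\quad\text{for }0<m<\tfrac12,$$ $$\frac{\pi m}{1-m}-\frac{m}{1-m}\arcsin\left(\frac{1-m}{1+m}\right)<p_2(m)<\frac{\pi m}{1-m}+\frac{m}{3m-1}\quad\text{for }\tfrac12\le m<1,$$ $$\frac{\pi m}{m-1}-\frac{m}{m-1}\arcsin\left(\frac{m-1}{m+1}\right)<p_2(m)<\frac{\pi m}{m-1}+\frac{m}{3-m}\quad\text{for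 }1<m\le2,$$ $$5.7<p_2(m)<2\pi\quad\text{for }m>2.$$ (d) For every $k\in\mathbb N$: $p_2(m)<\frac{\pi m}{1-m}$ for $m\in\left(\frac{k}{1+k},a_{1,k}\right]$; $p_2(m)>\frac{\pi m}{1-m}$ for $m\in\left[c_{1,k},\frac{1+k}{2+k}\right)$; $p_2(m)>\frac{\pi m}{m-1}$ for $m\in\left(\frac{k+2}{k+1},c_{2,k}\right]$; $p_2(m)<\frac{\pi m}{m-1}$ for $m\in\left[a_{2,k},\frac{k+1}{k}\right)$. (e) For every $m\in(0,1)\cup(1,+\infty)$ the function $p\mapsto g_2(p,m)$ changes its sign at $p=p_2(m)$. -/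

import Mathlib

open Real Set Filter Topology

noncomputable section

namespace PlateBall

/-- The function `g₂(p, m)`. -/
def g2 (p m : ℝ) : ℝ :=
  m * p * cos (p / m) * sin p - (p * cos p + (m ^ 2 - 1) * sin p) * sin (p / m)

/-- The set of positive roots of `p ↦ g₂(p, m)`. -/
def posRoots (m : ℝ) : Set ℝ := {p : ℝ | 0 < p ∧ g2 p m = 0}

/-- `p₂(m)`, the infimum of the positive roots of `p ↦ g₂(p, m)`. It is the minimal positive root
as soon as it is the least element of `posRoots m`, which is a part of the theorem. -/
def p2 (m : ℝ) : ℝ := sInf (posRoots m)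

/-- The parameter range `(0,1) ∪ (1,+∞)`. -/
def params : Set ℝ := Ioo 0 1 ∪ Ioi 1

/-- The point `(1+2k)/(3+2k)`. -/
def c1 (k : ℕ) : ℝ := (1 + 2 * (k : ℝ)) / (3 + 2 * (k : ℝ))

/-- The point `(1+2k)/(3+2k) - 2/(15+40k+32k²+8k³)`. -/
def a1 (k : ℕ) : ℝ :=
  c1 k - 2 / (15 + 40 * (k : ℝ) + 32 * (k : ℝ) ^ 2 + 8 * (k : ℝ) ^ 3)

/-- The point `(3+2k)/(1+2k)`. -/
def c2 (k : ℕ) : ℝ := (3 + 2 * (k : ℝ)) / (1 + 2 * (k : ℝ))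

/-- The point `(3+2k)/(1+2k) + 2/(1+8k(1+k²))`. -/
def a2 (k : ℕ) : ℝ := c2 k + 2 / (1 + 8 * (k : ℝ) * (1 + (k : ℝ) ^ 2))

/-- The derivative of `f` at `x` (two-sided limit of difference quotients) equals `+∞`. -/
def DerivEqTop (f : ℝ → ℝ) (x : ℝ) : Prop := Tendsto (slope f x) (𝓝[≠] x) atTop

/-- The derivative of `f` at `x` (two-sided limit of difference quotients) equals `-∞`. -/
def DerivEqBot (f : ℝ → ℝ) (x : ℝ) : Prop := Tendsto (slope f x) (𝓝[≠] x) atBot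

/-- `f` changes its sign at `x`: it has one strict sign immediately to the left of `x` and the
opposite strict sign immediately to the right of `x`. -/
def ChangesSignAt (f : ℝ → ℝ) (x : ℝ) : Prop :=
  ((∀ᶠ y in 𝓝[<] x, f y < 0) ∧ (∀ᶠ y in 𝓝[>] x, 0 < f y)) ∨
    ((∀ᶠ y in 𝓝[<] x, 0 < f y) ∧ (∀ᶠ y in 𝓝[>] x, f y < 0))

end PlateBall

end

noncomputable section

namespace PlateBall

/-! Put q = p/m. Up to sign, q² g₂(p, m) is the determinant of the vectors (`bu`, -`bv`) at p and at
q (`sq_mul_g2`). These vectors never vanish and turn counterclockwise along x > 0, so they have a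
strictly increasing continuous angle `phase`, and g₂(p, m) is a negative multiple of sin(`phase` q -
`phase` p) (`g2_eq_neg_mul_sin`).

Let m < 1, so that q > p. The first root is reached when the angle gap is exactly π, that is q =
`next p`, or m = p / `next p` = `ratio p`. The function `ratio` is a strictly increasing bijection
of (0, ∞) onto (0, 1), so p₂ is its inverse; this gives existence, continuity, monotonicity and the
sign change. Since x · `phaseDeriv x` is a π-periodic expression in the angle plus x² cos² of the
angle, the derivative of `ratio` is a positive multiple of cos²(`phase p`) (`ratioDeriv_eq`). Hence
p₂ is C¹ except where `bu` vanishes (tan p = p), and there its derivative is +∞.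

All inequalities come from the sign of g₂ at test points: g₂ > 0 at p gives p₂ < p, while g₂ < 0
gives p < p₂ if the angle gap is below 2π. On the hyperbola p = πm/(1-m) one has q = p + π and g₂
factors (`sq_mul_g2_hyperbola`); this locates m* and the singular point. The case m > 1 follows from
g₂(p, m) = -m² g₂(p/m, 1/m). -/

/-- `x² j₁(x)`, with `j₁` the spherical Bessel function. -/
def bu (x : ℝ) : ℝ := sin x - x * cos x

/-- `x³ j₀(x)`, with `j₀` the spherical Bessel function. -/
def bv (x : ℝ) : ℝ := x ^ 2 * sin x

/-! ### The Bessel pair and the determinant form of g₂ -/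

lemma hasDerivAt_bu (x : ℝ) : HasDerivAt bu (x * sin x) x := by
  have h := (hasDerivAt_sin x).sub ((hasDerivAt_id x).mul (hasDerivAt_cos x))
  refine h.congr_deriv ?_
  simp

lemma hasDerivAt_bv (x : ℝ) : HasDerivAt bv (2 * x * sin x + x ^ 2 * cos x) x := by
  have h := ((hasDerivAt_id x).pow 2).mul (hasDerivAt_sin x)
  refine h.congr_deriv ?_
  simp

lemma continuous_bu : Continuous bu :=
  continuous_iff_continuousAt.2 fun x => (hasDerivAt_bu x).continuousAt

lemma continuous_bv : Continuous bv :=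
  continuous_iff_continuousAt.2 fun x => (hasDerivAt_bv x).continuousAt

lemma sq_mul_g2 {p q : ℝ} (hq : q ≠ 0) (hp : p ≠ 0) :
    q ^ 2 * g2 p (p / q) = bu p * bv q - bv p * bu q := by
  have h : p / (p / q) = q := by field_simp
  unfold g2 bu bv
  rw [h]
  field_simp
  ring

lemma g2_inv {m : ℝ} (hm : m ≠ 0) (p : ℝ) : g2 p m = -m ^ 2 * g2 (p / m) (1 / m) := by
  have h : p / m / (1 / m) = p := by field_simp
  unfold g2
  rw [h]
  field_simp
  ring

lemma pos_of_deriv_pos {f f' : ℝ → ℝ} {b : ℝ} (hf : ∀ x, HasDerivAt f (f' x) x)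
    (h0 : f 0 = 0) (hpos : ∀ x, 0 < x → x < b → 0 < f' x) {x : ℝ} (hx : 0 < x) (hxb : x < b) :
    0 < f x := by
  have hmono : StrictMonoOn f (Icc 0 x) := by
    refine strictMonoOn_of_deriv_pos (convex_Icc 0 x)
      (fun y _ => (hf y).continuousAt.continuousWithinAt) fun y hy => ?_
    rw [interior_Icc] at hy
    rw [(hf y).deriv]
    exact hpos y hy.1 (hy.2.trans hxb)
  have := hmono (left_mem_Icc.2 hx.le) (right_mem_Icc.2 hx.le) hx
  rwa [h0] at this

lemma bu_pos {x : ℝ} (hx : 0 < x) (hxπ : x < π) : 0 < bu x :=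
  pos_of_deriv_pos hasDerivAt_bu (by simp [bu])
    (fun _ h0 h1 => mul_pos h0 (sin_pos_of_pos_of_lt_pi h0 h1)) hx hxπ

/-- The difference vanishes at 0 and has derivative (x/3) `bu x`. Used for the bound with the
constant 5.7. -/
lemma bv_div_three_lt_bu {x : ℝ} (hx : 0 < x) (hxπ : x < π) : bv x / 3 < bu x := by
  have h : ∀ x, HasDerivAt (fun x => bu x - bv x / 3) (x / 3 * bu x) x := fun x => by
    refine ((hasDerivAt_bu x).sub ((hasDerivAt_bv x).div_const 3)).congr_deriv ?_
    unfold bu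
    ring
  have := pos_of_deriv_pos h (by simp [bu, bv])
    (fun y h0 h1 => mul_pos (by positivity) (bu_pos h0 h1)) hx hxπ
  linarith

/-! ### The phase: a continuous increasing angle -/

/-- The numerator of the derivative of the phase, up to the factor `x²`. -/
lemma phase_numerator_pos {x : ℝ} (hx : 0 < x) :
    0 < x ^ 2 + x * sin x * cos x - 2 * sin x ^ 2 := by
  rcases lt_or_ge x 2 with h2 | h2
  · have h2π : (2 : ℝ) < π := by linarith [pi_gt_three]
    have hd1 : ∀ x : ℝ, HasDerivAt
        (fun x => 2 * x + x * (cos x ^ 2 - sin x ^ 2) - 3 * sin x * cos x)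
        (4 * sin x * bu x) x := fun x => by
      have hs := hasDerivAt_sin x
      have hc := hasDerivAt_cos x
      have hi := hasDerivAt_id x
      refine (((hi.const_mul 2).add (hi.mul ((hc.pow 2).sub (hs.pow 2)))).sub
        ((hs.const_mul 3).mul hc)).congr_deriv ?_
      have := sin_sq_add_cos_sq x
      simp only [bu, id, Pi.sub_apply, Pi.pow_apply]
      push_cast
      linear_combination (-2 : ℝ) * this
    have hd0 : ∀ x : ℝ, HasDerivAt (fun x => x ^ 2 + x * sin x * cos x - 2 * sin x ^ 2)
        (2 * x + x * (cos x ^ 2 - sin x ^ 2) - 3 * sin x * cos x) x := fun x => by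
      have hs := hasDerivAt_sin x
      have hc := hasDerivAt_cos x
      have hi := hasDerivAt_id x
      refine (((hi.pow 2).add ((hi.mul hs).mul hc)).sub ((hs.pow 2).const_mul 2)).congr_deriv ?_
      simp only [id, Pi.mul_apply]
      push_cast
      ring
    -- The function and its first derivative vanish at 0, and its second derivative is 4 sin x · `bu
    -- x`.
    refine pos_of_deriv_pos hd0 (by simp) (fun y hy hy2 => ?_) hx h2
    refine pos_of_deriv_pos hd1 (by simp) (fun z hz hz2 => ?_) hy hy2
    exact mul_pos (mul_pos (by norm_num) (sin_pos_of_pos_of_lt_pi hz (hz2.trans h2π)))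
      (bu_pos hz (hz2.trans h2π))
  -- Here crude bounds suffice: x sin x cos x ≥ -x/2 and sin² x ≤ 1.
  · have h1 := sin_sq_add_cos_sq x
    nlinarith [mul_nonneg hx.le (sq_nonneg (sin x + cos x)), sq_nonneg (cos x)]

lemma bu_sq_add_bv_sq_pos {x : ℝ} (hx : 0 < x) : 0 < bu x ^ 2 + bv x ^ 2 := by
  by_contra! h
  have hu : bu x = 0 := by nlinarith [sq_nonneg (bu x), sq_nonneg (bv x)]
  have hv : bv x = 0 := by nlinarith [sq_nonneg (bu x), sq_nonneg (bv x)]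
  have hs : sin x = 0 := by
    rcases mul_eq_zero.1 hv with h | h
    · exact absurd h (by positivity)
    · exact h
  have hc : cos x = 0 := by
    have : x * cos x = 0 := by unfold bu at hu; linarith
    exact (mul_eq_zero.1 this).resolve_left hx.ne'
  have := sin_sq_add_cos_sq x
  simp [hs, hc] at this

/-- Angular velocity (v u' - u v')/(u² + v²) of (u, -v) = (`bu`, -`bv`), rewritten with x u' = v and
x v' = 3v - x² u. -/
def phaseDeriv (x : ℝ) : ℝ :=
  (bv x ^ 2 - 3 * bu x * bv x + x ^ 2 * bu x ^ 2) / (x * (bu x ^ 2 + bv x ^ 2))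

lemma continuousOn_phaseDeriv : ContinuousOn phaseDeriv (Ioi 0) := by
  have hu := continuous_bu
  have hv := continuous_bv
  refine ContinuousOn.div (by fun_prop) (by fun_prop) fun x hx => ?_
  exact (mul_pos hx (bu_sq_add_bv_sq_pos hx)).ne'

lemma phaseDeriv_pos {x : ℝ} (hx : 0 < x) : 0 < phaseDeriv x := by
  refine div_pos ?_ (mul_pos hx (bu_sq_add_bv_sq_pos hx))
  have h : bv x ^ 2 - 3 * bu x * bv x + x ^ 2 * bu x ^ 2
      = x ^ 2 * (x ^ 2 + x * sin x * cos x - 2 * sin x ^ 2) := by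
    unfold bu bv
    linear_combination x ^ 4 * sin_sq_add_cos_sq x
  rw [h]
  exact mul_pos (by positivity) (phase_numerator_pos hx)

/-- A continuous angle of the vector `(bu x, -bv x)`, for `x > 0`. -/
def phase (x : ℝ) : ℝ := ∫ t in π..x, phaseDeriv t

lemma hasDerivAt_phase {x : ℝ} (hx : 0 < x) : HasDerivAt phase (phaseDeriv x) x := by
  have hsub : uIcc π x ⊆ Ioi 0 := fun y hy => (lt_min pi_pos hx).trans_le hy.1
  refine intervalIntegral.integral_hasDerivAt_right
    (continuousOn_phaseDeriv.mono hsub).intervalIntegrable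
    (continuousOn_phaseDeriv.stronglyMeasurableAtFilter isOpen_Ioi x hx)
    (continuousOn_phaseDeriv.continuousAt (Ioi_mem_nhds hx))

lemma continuousOn_phase : ContinuousOn phase (Ioi 0) :=
  fun _ hx => (hasDerivAt_phase hx).continuousAt.continuousWithinAt

lemma strictMonoOn_phase : StrictMonoOn phase (Ioi 0) := by
  refine strictMonoOn_of_deriv_pos (convex_Ioi 0) continuousOn_phase fun x hx => ?_
  rw [interior_Ioi] at hx
  rw [(hasDerivAt_phase hx).deriv]
  exact phaseDeriv_pos hx

@[simp] lemma phase_pi : phase π = 0 := by simp [phase]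

/-- The squared component of (u, -v) normal to the direction `phase`, divided by u² + v², has zero
derivative, and it vanishes at π because `bv π = 0`. -/
lemma bu_mul_sin_phase {x : ℝ} (hx : 0 < x) :
    bu x * sin (phase x) + bv x * cos (phase x) = 0 := by
  set F : ℝ → ℝ := fun x =>
    (bu x * sin (phase x) + bv x * cos (phase x)) ^ 2 / (bu x ^ 2 + bv x ^ 2) with hF
  have hd : ∀ y ∈ Ioi (0 : ℝ), HasDerivAt F 0 y := fun y hy => by
    have hy' : (0 : ℝ) < y := hy
    have h1 := hasDerivAt_bu y
    have h2 := hasDerivAt_bv y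
    have h3 := (hasDerivAt_phase hy').sin
    have h4 := (hasDerivAt_phase hy').cos
    have hpos := bu_sq_add_bv_sq_pos hy'
    refine ((((h1.mul h3).add (h2.mul h4)).pow 2).div ((h1.pow 2).add (h2.pow 2))
      hpos.ne').congr_deriv ?_
    simp only [Pi.add_apply, Pi.mul_apply, Pi.pow_apply]
    rw [div_eq_zero_iff]
    left
    have hR : phaseDeriv y * (y * (bu y ^ 2 + bv y ^ 2)) =
        bv y ^ 2 - 3 * bu y * bv y + y ^ 2 * bu y ^ 2 := by
      unfold phaseDeriv
      exact div_mul_cancel₀ _ (mul_pos hy' hpos).ne'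
    set w := phaseDeriv y
    set S := sin (phase y)
    set C := cos (phase y)
    have hW : w * (bu y ^ 2 + bv y ^ 2) = (y * sin y) * bv y -
        (2 * y * sin y + y ^ 2 * cos y) * bu y := by
      apply mul_left_cancel₀ hy'.ne'
      rw [← mul_assoc, mul_comm y w, mul_assoc, hR]
      unfold bu bv
      ring
    push_cast
    linear_combination (2 * (bu y * S + bv y * C) * (bu y * C - bv y * S)) * hW
  have hconst : F x = F π := by
    refine (convex_Ioi (0 : ℝ)).is_const_of_fderivWithin_eq_zero (𝕜 := ℝ)
      (fun y hy => (hd y hy).differentiableAt.differentiableWithinAt) (fun y hy => ?_) hx pi_pos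
    rw [fderivWithin_of_isOpen isOpen_Ioi hy]
    ext
    simp [(hd y hy).deriv]
  have hFπ : F π = 0 := by simp [hF, bv]
  rw [hFπ, hF] at hconst
  rcases div_eq_zero_iff.1 hconst with h | h
  · exact pow_eq_zero_iff (two_ne_zero) |>.1 h
  · exact absurd h (bu_sq_add_bv_sq_pos hx).ne'

/-- The normal component being zero, the component along the direction `phase` never vanishes; it is
positive at π, hence everywhere by connectedness. -/
lemma bu_mul_cos_phase_pos {x : ℝ} (hx : 0 < x) :
    0 < bu x * cos (phase x) - bv x * sin (phase x) := by
  set f : ℝ → ℝ := fun x => bu x * cos (phase x) - bv x * sin (phase x) with hf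
  have hcont : ContinuousOn f (Ioi 0) :=
    (continuous_bu.continuousOn.mul (continuous_cos.comp_continuousOn continuousOn_phase)).sub
      (continuous_bv.continuousOn.mul (continuous_sin.comp_continuousOn continuousOn_phase))
  have hne : ∀ y ∈ Ioi (0 : ℝ), f y ≠ 0 := fun y hy h0 => by
    have h1 := bu_mul_sin_phase hy
    have h2 := sin_sq_add_cos_sq (phase y)
    have h3 := bu_sq_add_bv_sq_pos hy
    simp only [hf] at h0
    have : bu y ^ 2 + bv y ^ 2 = 0 := by
      linear_combination (-(bu y ^ 2 + bv y ^ 2)) * h2 +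
        (bu y * cos (phase y) - bv y * sin (phase y)) * h0 +
        (bu y * sin (phase y) + bv y * cos (phase y)) * h1
    exact h3.ne' this
  have hπ : 0 < f π := by simp [hf, bu, pi_pos]
  by_contra! hneg
  obtain ⟨y, hy, hy0⟩ := isPreconnected_Ioi.intermediate_value hx pi_pos hcont ⟨hneg, hπ.le⟩
  exact hne y hy hy0

/-- The polar form of `(bu x, -bv x)`. -/
lemma exists_polar {x : ℝ} (hx : 0 < x) :
    ∃ r, 0 < r ∧ bu x = r * cos (phase x) ∧ bv x = -(r * sin (phase x)) := by
  refine ⟨_, bu_mul_cos_phase_pos hx, ?_, ?_⟩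
  · linear_combination (-bu x) * sin_sq_add_cos_sq (phase x) + sin (phase x) * bu_mul_sin_phase hx
  · linear_combination (-bv x) * sin_sq_add_cos_sq (phase x) + cos (phase x) * bu_mul_sin_phase hx

lemma mul_phaseDeriv {x : ℝ} (hx : 0 < x) :
    x * phaseDeriv x = sin (phase x) ^ 2 + 3 * sin (phase x) * cos (phase x) +
      x ^ 2 * cos (phase x) ^ 2 := by
  obtain ⟨r, hr, hu, hv⟩ := exists_polar hx
  have h1 : bu x ^ 2 + bv x ^ 2 = r ^ 2 := by
    rw [hu, hv]
    linear_combination r ^ 2 * sin_sq_add_cos_sq (phase x)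
  unfold phaseDeriv
  rw [h1, hu, hv]
  field_simp
  ring

lemma sin_phase_eq_zero_iff {x : ℝ} (hx : 0 < x) : sin (phase x) = 0 ↔ sin x = 0 := by
  obtain ⟨r, hr, -, hv⟩ := exists_polar hx
  unfold bv at hv
  constructor <;> intro h
  · rw [h] at hv
    have : x ^ 2 * sin x = 0 := by linarith
    exact (mul_eq_zero.1 this).resolve_left (by positivity)
  · rw [h] at hv
    have : r * sin (phase x) = 0 := by linarith
    exact (mul_eq_zero.1 this).resolve_left hr.ne'

lemma sin_ne_zero_of_mem {j : ℕ} {x : ℝ} (h1 : j * π < x) (h2 : x < (j + 1) * π) :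
    sin x ≠ 0 := fun h => by
  obtain ⟨n, rfl⟩ := sin_eq_zero_iff.1 h
  have h1' : (j : ℝ) < n := lt_of_mul_lt_mul_right h1 pi_pos.le
  have h2' : (n : ℝ) < (j : ℝ) + 1 := lt_of_mul_lt_mul_right h2 pi_pos.le
  have h3 : (j : ℤ) < n := by exact_mod_cast h1'
  have h4 : n < (j : ℤ) + 1 := by exact_mod_cast h2'
  omega

/-- Otherwise the phase takes the value -π inside (0, π), where sin has no zero. -/
lemma neg_pi_lt_phase {x : ℝ} (hx : 0 < x) : -π < phase x := by
  by_contra! h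
  have hxπ : x < π := by
    by_contra! h'
    have := strictMonoOn_phase.monotoneOn (a := π) pi_pos hx h'
    rw [phase_pi] at this
    linarith [pi_pos]
  have hc : ContinuousOn phase (Icc x π) :=
    continuousOn_phase.mono fun y hy => hx.trans_le hy.1
  obtain ⟨y, hy, hy0⟩ := intermediate_value_Icc hxπ.le hc
    (show -π ∈ Icc (phase x) (phase π) from ⟨h, by simp [pi_pos.le]⟩)
  have hy' : y < π := lt_of_le_of_ne hy.2 fun hyπ => by
    rw [hyπ, phase_pi] at hy0
    linarith [pi_pos]
  have hypos := hx.trans_le hy.1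
  have hs : sin y = 0 := (sin_phase_eq_zero_iff hypos).1 (by simp [hy0])
  exact (sin_pos_of_pos_of_lt_pi hypos hy').ne' hs

/-- The phase is a multiple of π exactly at zeros of sin; between consecutive zeros it can therefore
skip no multiple. -/
lemma phase_add_one_mul_pi (j : ℕ) : phase ((j + 1) * π) = j * π := by
  induction j with
  | zero => simp
  | succ j ih =>
    push_cast
    have hpos : 0 < ((j : ℝ) + 1) * π := by positivity
    have hpos' : 0 < ((j : ℝ) + 1 + 1) * π := by positivity
    have hlt : ((j : ℝ) + 1) * π < ((j : ℝ) + 1 + 1) * π := by nlinarith [pi_pos]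
    obtain ⟨n, hn⟩ := sin_eq_zero_iff.1 ((sin_phase_eq_zero_iff hpos').2
      (by exact_mod_cast sin_nat_mul_pi (j + 1 + 1)))
    have hm := strictMonoOn_phase hpos hpos' hlt
    rw [ih, ← hn] at hm
    have h3 : (j : ℤ) < n := by exact_mod_cast lt_of_mul_lt_mul_right hm pi_pos.le
    rcases (show n = j + 1 ∨ (j : ℤ) + 1 < n by omega) with h | h
    · rw [← hn, h]
      push_cast
      ring
    · exfalso
      have hc : ContinuousOn phase (Icc (((j : ℝ) + 1) * π) (((j : ℝ) + 1 + 1) * π)) :=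
        continuousOn_phase.mono fun y hy => hpos.trans_le hy.1
      have h' : (j : ℝ) + 1 < n := by exact_mod_cast h
      obtain ⟨y, hy, hy0⟩ := intermediate_value_Ioo hlt.le hc
        (show ((j : ℝ) + 1) * π ∈ Ioo _ _ from by
          rw [ih, ← hn]
          constructor <;> nlinarith [pi_pos])
      have hypos := hpos.trans hy.1
      have hs : sin y = 0 := (sin_phase_eq_zero_iff hypos).1
        (by rw [hy0]; exact_mod_cast sin_nat_mul_pi (j + 1))
      exact sin_ne_zero_of_mem (j := j + 1) (by exact_mod_cast hy.1) (by exact_mod_cast hy.2) hs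

/-- For jπ ≤ x < (j+1)π the phase is at least (j-1)π at x (above -π if j = 0) and below (j+1)π at x
+ π. This supplies the gap condition for test points on or below the hyperbola. -/
lemma phase_add_pi_lt {x : ℝ} (hx : 0 < x) : phase (x + π) < phase x + 2 * π := by
  have h0 : 0 ≤ x / π := by positivity
  set j := ⌊x / π⌋₊
  have h1 : j * π ≤ x := by
    have := Nat.floor_le h0
    exact (le_div_iff₀ pi_pos).1 this
  have h2 : x < (j + 1) * π := by
    have := Nat.lt_floor_add_one (x / π)
    exact (div_lt_iff₀ pi_pos).1 this
  have h3 : phase (x + π) < (j + 1) * π := by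
    have := phase_add_one_mul_pi (j + 1)
    push_cast at this
    rw [← this]
    exact strictMonoOn_phase (show 0 < x + π by positivity)
      (show 0 < ((j : ℝ) + 1 + 1) * π by positivity) (by linarith)
  rcases Nat.eq_zero_or_pos j with hj | hj
  · have := neg_pi_lt_phase hx
    rw [hj] at h3
    push_cast at h3
    linarith
  · obtain ⟨i, hi⟩ := Nat.exists_eq_succ_of_ne_zero hj.ne'
    rw [hi] at h1 h3
    push_cast at h1 h3
    have := strictMonoOn_phase.monotoneOn (show 0 < ((i : ℝ) + 1) * π by positivity) hx h1
    rw [phase_add_one_mul_pi] at this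
    linarith

/-! ### Implicit functions; `next` and `ratio` -/

lemma continuousAt_of_strictMonoOn_comp {f g k : ℝ → ℝ} {a : ℝ} (hf : StrictMonoOn f (Ioi 0))
    (hg : ∀ᶠ y in 𝓝 a, 0 < g y ∧ f (g y) = k y) (hk : ContinuousAt k a) : ContinuousAt g a := by
  obtain ⟨ha0, ha⟩ := hg.self_of_nhds
  refine tendsto_order.2 ⟨fun l hl => ?_, fun l hl => ?_⟩
  · rcases le_or_gt l 0 with h0 | h0
    · filter_upwards [hg] with y hy using h0.trans_lt hy.1
    · have h1 : f l < k a := ha ▸ hf h0 ha0 hl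
      filter_upwards [hg, hk.eventually_const_lt h1] with y hy hly
      exact (hf.lt_iff_lt h0 hy.1).1 (hy.2 ▸ hly)
  · have h0 : 0 < l := ha0.trans hl
    have h1 : k a < f l := ha ▸ hf ha0 h0 hl
    filter_upwards [hg, hk.eventually_lt_const h1] with y hy hly
    exact (hf.lt_iff_lt hy.1 h0).1 (hy.2 ▸ hly)

/-- Implicit differentiation: the slope of k is the slope of g times `dslope f` taken along g. It
serves both `next` and p₂. -/
lemma hasDerivAt_of_comp_eq {f g k : ℝ → ℝ} {a f' k' : ℝ} (hg : ContinuousAt g a)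
    (hf : HasDerivAt f f' (g a)) (hk : HasDerivAt k k' a) (hf' : f' ≠ 0)
    (h : ∀ᶠ y in 𝓝 a, f (g y) = k y) : HasDerivAt g (k' / f') a := by
  rw [hasDerivAt_iff_tendsto_slope] at hk ⊢
  have hds : Tendsto (fun y => dslope f (g a) (g y)) (𝓝[≠] a) (𝓝 f') := by
    have hc : ContinuousAt (dslope f (g a)) (g a) :=
      continuousAt_dslope_same.2 hf.differentiableAt
    have h1 : Tendsto (dslope f (g a)) (𝓝 (g a)) (𝓝 f') := by
      have := hc.tendsto
      rwa [dslope_same, hf.deriv] at this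
    exact (h1.comp hg.tendsto).mono_left nhdsWithin_le_nhds
  refine (hk.div hds hf').congr' ?_
  filter_upwards [hds.eventually_ne hf', h.filter_mono nhdsWithin_le_nhds,
    self_mem_nhdsWithin] with y hy0 hy hya
  have hya' : y - a ≠ 0 := sub_ne_zero.2 hya
  have h1 : (g y - g a) * dslope f (g a) (g y) = k y - k a := by
    rw [← hy, ← h.self_of_nhds, ← smul_eq_mul, sub_smul_dslope]
  rw [Pi.div_apply, slope_def_field, slope_def_field, ← h1]
  field_simp

lemma exists_phase_eq_add_pi {p : ℝ} (hp : 0 < p) : ∃ q, 0 < q ∧ phase q = phase p + π := by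
  obtain ⟨N, hN⟩ := exists_nat_gt ((phase p + π) / π)
  have hN' : phase p + π < N * π := (div_lt_iff₀ pi_pos).1 hN
  have hc : ContinuousOn phase (uIcc p ((N + 1) * π)) :=
    continuousOn_phase.mono fun y hy => (lt_min hp (by positivity)).trans_le hy.1
  obtain ⟨q, hq, hq0⟩ := intermediate_value_uIcc hc
    (show phase p + π ∈ uIcc _ _ from by
      rw [phase_add_one_mul_pi]
      exact Icc_subset_uIcc ⟨by linarith [pi_pos], hN'.le⟩)
  exact ⟨q, (lt_min hp (by positivity)).trans_le hq.1, hq0⟩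

/-- The point at which the phase is `π` ahead of its value at `p`. -/
def next (p : ℝ) : ℝ := if h : 0 < p then (exists_phase_eq_add_pi h).choose else 0

lemma next_pos {p : ℝ} (hp : 0 < p) : 0 < next p := by
  rw [next, dif_pos hp]
  exact (exists_phase_eq_add_pi hp).choose_spec.1

lemma phase_next {p : ℝ} (hp : 0 < p) : phase (next p) = phase p + π := by
  rw [next, dif_pos hp]
  exact (exists_phase_eq_add_pi hp).choose_spec.2

lemma next_eq {p q : ℝ} (hp : 0 < p) (hq : 0 < q) (h : phase q = phase p + π) : next p = q :=
  strictMonoOn_phase.injOn (next_pos hp) hq ((phase_next hp).trans h.symm)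

lemma lt_next {p : ℝ} (hp : 0 < p) : p < next p :=
  (strictMonoOn_phase.lt_iff_lt hp (next_pos hp)).1 (by rw [phase_next hp]; linarith [pi_pos])

lemma continuousAt_next {p : ℝ} (hp : 0 < p) : ContinuousAt next p := by
  refine continuousAt_of_strictMonoOn_comp (k := fun p => phase p + π) strictMonoOn_phase ?_
    ((hasDerivAt_phase hp).continuousAt.add continuousAt_const)
  filter_upwards [Ioi_mem_nhds hp] with y hy using ⟨next_pos hy, phase_next hy⟩

lemma hasDerivAt_next {p : ℝ} (hp : 0 < p) :
    HasDerivAt next (phaseDeriv p / phaseDeriv (next p)) p := by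
  refine hasDerivAt_of_comp_eq (continuousAt_next hp) (hasDerivAt_phase (next_pos hp))
    ((hasDerivAt_phase hp).add_const π) (phaseDeriv_pos (next_pos hp)).ne' ?_
  filter_upwards [Ioi_mem_nhds hp] with y hy using phase_next hy

/-- The slope of the ray through `(next p, p)`. -/
def ratio (p : ℝ) : ℝ := p / next p

/-- The derivative of `ratio`. -/
def ratioDeriv (p : ℝ) : ℝ :=
  (1 * next p - p * (phaseDeriv p / phaseDeriv (next p))) / next p ^ 2

lemma hasDerivAt_ratio {p : ℝ} (hp : 0 < p) : HasDerivAt ratio (ratioDeriv p) p :=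
  (hasDerivAt_id p).div (hasDerivAt_next hp) (next_pos hp).ne'

/-- In `mul_phaseDeriv` at p and `next p` the angles differ by π, so the sin² and sin · cos terms
agree and only (q² - p²) cos² survives the subtraction. -/
lemma ratioDeriv_eq {p : ℝ} (hp : 0 < p) :
    ratioDeriv p = (next p ^ 2 - p ^ 2) * cos (phase p) ^ 2 /
      (phaseDeriv (next p) * next p ^ 2) := by
  have hq := next_pos hp
  have h1 := mul_phaseDeriv hp
  have h2 := mul_phaseDeriv hq
  rw [phase_next hp, sin_add_pi, cos_add_pi] at h2
  have h3 := (phaseDeriv_pos hq).ne'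
  unfold ratioDeriv
  rw [div_eq_div_iff (by positivity) (mul_ne_zero h3 (by positivity))]
  field_simp
  linear_combination h2 - h1

lemma ratioDeriv_nonneg {p : ℝ} (hp : 0 < p) : 0 ≤ ratioDeriv p := by
  rw [ratioDeriv_eq hp]
  have h1 : 0 < next p ^ 2 - p ^ 2 := by nlinarith [lt_next hp]
  have := phaseDeriv_pos (next_pos hp)
  have := next_pos hp
  positivity

lemma ratioDeriv_eq_zero_iff {p : ℝ} (hp : 0 < p) : ratioDeriv p = 0 ↔ cos (phase p) = 0 := by
  rw [ratioDeriv_eq hp]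
  have h1 : next p ^ 2 - p ^ 2 ≠ 0 := by nlinarith [lt_next hp]
  have h2 := (phaseDeriv_pos (next_pos hp)).ne'
  have h3 := (next_pos hp).ne'
  simp [h1, h2, h3]

lemma continuousOn_ratioDeriv : ContinuousOn ratioDeriv (Ioi 0) := by
  have hn : ContinuousOn next (Ioi 0) := fun p hp => (continuousAt_next hp).continuousWithinAt
  have hd := continuousOn_phaseDeriv
  have hdn : ContinuousOn (fun p => phaseDeriv (next p)) (Ioi 0) :=
    hd.comp hn fun p hp => next_pos hp
  refine ContinuousOn.div ((continuousOn_const.mul hn).sub (continuousOn_id.mul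
    (hd.div hdn fun p hp => (phaseDeriv_pos (next_pos hp)).ne'))) (hn.pow 2)
    fun p hp => (pow_pos (next_pos hp) 2).ne'

lemma continuousOn_ratio : ContinuousOn ratio (Ioi 0) :=
  fun _ hp => (hasDerivAt_ratio hp).continuousAt.continuousWithinAt

lemma strictMonoOn_ratio : StrictMonoOn ratio (Ioi 0) := by
  have hmono : MonotoneOn ratio (Ioi 0) := by
    refine monotoneOn_of_deriv_nonneg (convex_Ioi 0) continuousOn_ratio
      (fun x hx => ?_) fun x hx => ?_ <;> rw [interior_Ioi] at hx
    · exact (hasDerivAt_ratio hx).differentiableAt.differentiableWithinAt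
    · rw [(hasDerivAt_ratio hx).deriv]
      exact ratioDeriv_nonneg hx
  intro a ha b hb hab
  refine lt_of_le_of_ne (hmono ha hb hab.le) fun heq => ?_
  -- Equal end values would make `ratio` constant on (a, b), so cos(`phase`) would vanish
  -- identically there, although the phase has positive speed.
  have hcos : ∀ x ∈ Ioo a b, cos (phase x) = 0 := fun x hx => by
    have hx0 : 0 < x := lt_trans ha hx.1
    rw [← ratioDeriv_eq_zero_iff hx0]
    have hc : ratio =ᶠ[𝓝 x] fun _ => ratio a := by
      filter_upwards [Ioo_mem_nhds hx.1 hx.2] with y hy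
      have hy0 : 0 < y := lt_trans ha hy.1
      exact le_antisymm (heq ▸ hmono hy0 hb hy.2.le) (hmono ha hy0 hy.1.le)
    exact (hasDerivAt_ratio hx0).unique ((hasDerivAt_const x (ratio a)).congr_of_eventuallyEq hc)
  have hm : (a + b) / 2 ∈ Ioo a b := ⟨by linarith, by linarith⟩
  have hm0 : 0 < (a + b) / 2 := lt_trans ha hm.1
  have h1 : HasDerivAt (fun x => cos (phase x)) 0 ((a + b) / 2) :=
    (hasDerivAt_const _ (0 : ℝ)).congr_of_eventuallyEq (by
      filter_upwards [Ioo_mem_nhds hm.1 hm.2] with y hy using hcos y hy)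
  have h2 := h1.unique (hasDerivAt_phase hm0).cos
  have h3 := hcos _ hm
  have h4 := sin_sq_add_cos_sq (phase ((a + b) / 2))
  rw [h3] at h4
  have h5 := (phaseDeriv_pos hm0).ne'
  rcases mul_eq_zero.1 h2.symm with h | h
  · have : sin (phase ((a + b) / 2)) = 0 := by linarith
    rw [this] at h4
    norm_num at h4
  · exact h5 h

lemma ratio_mul_pi (j : ℕ) : ratio ((j + 1) * π) = (j + 1) / (j + 2) := by
  have h : next ((j + 1) * π) = (j + 2) * π := by
    refine next_eq (by positivity) (by positivity) ?_
    have := phase_add_one_mul_pi (j + 1)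
    push_cast at this
    rw [phase_add_one_mul_pi, show ((j : ℝ) + 2) = j + 1 + 1 by ring, this]
    ring
  rw [ratio, h]
  have := pi_pos
  field_simp

lemma pi_lt_next {p : ℝ} (hp : 0 < p) : π < next p := by
  rw [← strictMonoOn_phase.lt_iff_lt pi_pos (next_pos hp), phase_pi, phase_next hp]
  linarith [neg_pi_lt_phase hp]

/-- Intermediate values: `ratio (m * π)` is at most m because `next` exceeds π, and `ratio` at
(N+1)π is (N+1)/(N+2), which tends to 1. -/
lemma exists_ratio_eq {m : ℝ} (h0 : 0 < m) (h1 : m < 1) : ∃ p, 0 < p ∧ ratio p = m := by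
  obtain ⟨N, hN⟩ := exists_nat_gt (1 / (1 - m))
  have hm' : 0 < 1 - m := by linarith
  have hN' : 1 < N * (1 - m) := (div_lt_iff₀ hm').1 hN
  have ha : 0 < m * π := by positivity
  have hb : 0 < ((N : ℝ) + 1) * π := by positivity
  have hra : ratio (m * π) ≤ m := by
    have := pi_lt_next ha
    rw [ratio, div_le_iff₀ (next_pos ha)]
    exact mul_le_mul_of_nonneg_left this.le h0.le
  have hrb : m ≤ ratio ((N + 1) * π) := by
    rw [ratio_mul_pi, le_div_iff₀ (by positivity)]
    nlinarith
  obtain ⟨p, hp, hpm⟩ := isPreconnected_Ioi.intermediate_value ha hb continuousOn_ratio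
    ⟨hra, hrb⟩
  exact ⟨p, hp, hpm⟩

/-! ### Sign of g₂, and p₂ as the inverse of `ratio` -/

lemma g2_eq_neg_mul_sin {p m : ℝ} (hp : 0 < p) (hm : 0 < m) :
    ∃ r, 0 < r ∧ g2 p m = -(r * sin (phase (p / m) - phase p)) := by
  have hq : 0 < p / m := by positivity
  obtain ⟨r, hr, hu, hv⟩ := exists_polar hp
  obtain ⟨s, hs, hu', hv'⟩ := exists_polar hq
  have h := sq_mul_g2 hq.ne' hp.ne'
  rw [show p / (p / m) = m by field_simp, hu, hv, hu', hv'] at h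
  refine ⟨r * s / (p / m) ^ 2, by positivity, ?_⟩
  apply mul_left_cancel₀ (pow_pos hq 2).ne'
  rw [h, sin_sub]
  field_simp
  ring

lemma lt_ratio_iff {p m : ℝ} (hp : 0 < p) (hm : 0 < m) :
    m < ratio p ↔ phase p + π < phase (p / m) := by
  rw [← phase_next hp, strictMonoOn_phase.lt_iff_lt (next_pos hp) (show 0 < p / m by positivity),
    ratio, lt_div_iff₀ (next_pos hp), lt_div_iff₀ hm, mul_comm]

lemma ratio_lt_iff {p m : ℝ} (hp : 0 < p) (hm : 0 < m) :
    ratio p < m ↔ phase (p / m) < phase p + π := by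
  rw [← phase_next hp, strictMonoOn_phase.lt_iff_lt (show 0 < p / m by positivity) (next_pos hp),
    ratio, div_lt_iff₀ (next_pos hp), div_lt_iff₀ hm, mul_comm]

lemma phase_lt_phase_div {p m : ℝ} (hp : 0 < p) (hm : 0 < m) (hm1 : m < 1) :
    phase p < phase (p / m) :=
  strictMonoOn_phase hp (show 0 < p / m by positivity) ((lt_div_iff₀ hm).2 (by nlinarith))

lemma g2_neg {p m : ℝ} (hp : 0 < p) (hm : 0 < m) (hm1 : m < 1) (h : ratio p < m) :
    g2 p m < 0 := by
  obtain ⟨r, hr, hg⟩ := g2_eq_neg_mul_sin hp hm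
  have h1 := phase_lt_phase_div hp hm hm1
  have h2 := (ratio_lt_iff hp hm).1 h
  rw [hg]
  have := sin_pos_of_pos_of_lt_pi (sub_pos.2 h1) (by linarith)
  nlinarith

/-- The angle gap lies in (π, 2π); without the upper bound further sign changes would be possible.
-/
lemma g2_pos {p m : ℝ} (hp : 0 < p) (hm : 0 < m) (h : m < ratio p)
    (h2 : phase (p / m) < phase p + 2 * π) : 0 < g2 p m := by
  obtain ⟨r, hr, hg⟩ := g2_eq_neg_mul_sin hp hm
  have h1 := (lt_ratio_iff hp hm).1 h
  rw [hg]
  have := sin_pos_of_pos_of_lt_pi (x := phase (p / m) - phase p - π)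
    (by linarith) (by linarith)
  rw [sin_sub_pi] at this
  nlinarith

lemma isLeast_posRoots {p m : ℝ} (hp : 0 < p) (hm : 0 < m) (hm1 : m < 1) (h : ratio p = m) :
    IsLeast (posRoots m) p := by
  refine ⟨⟨hp, ?_⟩, fun x hx => ?_⟩
  · obtain ⟨r, hr, hg⟩ := g2_eq_neg_mul_sin hp hm
    have : p / m = next p := by
      rw [← h, ratio]
      have := (next_pos hp).ne'
      field_simp
    rw [hg, this, phase_next hp]
    simp
  · by_contra! hlt
    have := strictMonoOn_ratio hx.1 hp hlt
    exact (g2_neg hx.1 hm hm1 (h ▸ this)).ne hx.2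

lemma p2_pos_and_ratio {m : ℝ} (hm : m ∈ Ioo (0 : ℝ) 1) : 0 < p2 m ∧ ratio (p2 m) = m := by
  obtain ⟨p, hp, h⟩ := exists_ratio_eq hm.1 hm.2
  rw [p2, (isLeast_posRoots hp hm.1 hm.2 h).csInf_eq]
  exact ⟨hp, h⟩

lemma p2_pos {m : ℝ} (hm : m ∈ Ioo (0 : ℝ) 1) : 0 < p2 m := (p2_pos_and_ratio hm).1

lemma ratio_p2 {m : ℝ} (hm : m ∈ Ioo (0 : ℝ) 1) : ratio (p2 m) = m := (p2_pos_and_ratio hm).2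

lemma ratio_mem {p : ℝ} (hp : 0 < p) : ratio p ∈ Ioo (0 : ℝ) 1 :=
  ⟨div_pos hp (next_pos hp), (div_lt_one (next_pos hp)).2 (lt_next hp)⟩

lemma p2_ratio {p : ℝ} (hp : 0 < p) : p2 (ratio p) = p :=
  strictMonoOn_ratio.injOn (p2_pos (ratio_mem hp)) hp (ratio_p2 (ratio_mem hp))

lemma isLeast_p2 {m : ℝ} (hm : m ∈ Ioo (0 : ℝ) 1) : IsLeast (posRoots m) (p2 m) :=
  isLeast_posRoots (p2_pos hm) hm.1 hm.2 (ratio_p2 hm)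

lemma lt_p2_iff {p m : ℝ} (hm : m ∈ Ioo (0 : ℝ) 1) (hp : 0 < p) : p < p2 m ↔ ratio p < m := by
  rw [← strictMonoOn_ratio.lt_iff_lt hp (p2_pos hm), ratio_p2 hm]

lemma p2_lt_iff {p m : ℝ} (hm : m ∈ Ioo (0 : ℝ) 1) (hp : 0 < p) : p2 m < p ↔ m < ratio p := by
  rw [← strictMonoOn_ratio.lt_iff_lt (p2_pos hm) hp, ratio_p2 hm]

/-- No gap condition is needed, since g₂ is negative all the way up to the first root. -/
lemma p2_lt_of_g2_pos {p m : ℝ} (hm : m ∈ Ioo (0 : ℝ) 1) (hp : 0 < p) (h : 0 < g2 p m) :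
    p2 m < p := by
  by_contra! hle
  rcases hle.lt_or_eq with hlt | heq
  · exact (g2_neg hp hm.1 hm.2 ((lt_p2_iff hm hp).1 hlt)).not_gt h
  · exact h.ne' (heq ▸ (isLeast_p2 hm).1.2)

lemma lt_p2_of_g2_neg {p m : ℝ} (hm : m ∈ Ioo (0 : ℝ) 1) (hp : 0 < p) (h : g2 p m < 0)
    (h2 : phase (p / m) < phase p + 2 * π) : p < p2 m := by
  by_contra! hle
  rcases hle.lt_or_eq with hlt | heq
  · exact (g2_pos hp hm.1 ((p2_lt_iff hm hp).1 hlt) h2).not_gt h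
  · exact h.ne (heq ▸ (isLeast_p2 hm).1.2)

lemma strictMonoOn_p2 : StrictMonoOn p2 (Ioo 0 1) := fun a ha b hb hab => by
  rwa [p2_lt_iff ha (p2_pos hb), ratio_p2 hb]

lemma continuousAt_p2 {m : ℝ} (hm : m ∈ Ioo (0 : ℝ) 1) : ContinuousAt p2 m := by
  refine continuousAt_of_strictMonoOn_comp (k := id) strictMonoOn_ratio ?_ continuousAt_id
  filter_upwards [Ioo_mem_nhds hm.1 hm.2] with y hy using p2_pos_and_ratio hy

lemma hasDerivAt_p2 {m : ℝ} (hm : m ∈ Ioo (0 : ℝ) 1) (h : cos (phase (p2 m)) ≠ 0) :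
    HasDerivAt p2 (1 / ratioDeriv (p2 m)) m := by
  have h' := mt (ratioDeriv_eq_zero_iff (p2_pos hm)).1 h
  refine hasDerivAt_of_comp_eq (continuousAt_p2 hm) (hasDerivAt_ratio (p2_pos hm))
    (hasDerivAt_id m) h' ?_
  filter_upwards [Ioo_mem_nhds hm.1 hm.2] with y hy using ratio_p2 hy

lemma contDiffAt_p2 {m : ℝ} (hm : m ∈ Ioo (0 : ℝ) 1) (h : cos (phase (p2 m)) ≠ 0) :
    ContDiffAt ℝ 1 p2 m := by
  have hev : ∀ᶠ y in 𝓝 m, y ∈ Ioo (0 : ℝ) 1 ∧ cos (phase (p2 y)) ≠ 0 := by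
    refine Filter.Eventually.and (Ioo_mem_nhds hm.1 hm.2) ?_
    exact (continuous_cos.continuousAt.comp ((hasDerivAt_phase (p2_pos hm)).continuousAt.comp
      (continuousAt_p2 hm))).eventually_ne h
  rw [contDiffAt_one_iff]
  refine ⟨fun y => ContinuousLinearMap.toSpanSingleton ℝ (1 / ratioDeriv (p2 y)), _, hev,
    fun y hy => ?_, fun y hy => (hasDerivAt_p2 hy.1 hy.2).hasFDerivAt⟩
  refine ContinuousAt.continuousWithinAt ?_
  have h' := mt (ratioDeriv_eq_zero_iff (p2_pos hy.1)).1 hy.2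
  have hc : ContinuousAt (fun y => 1 / ratioDeriv (p2 y)) y :=
    continuousAt_const.div (ContinuousAt.comp (continuousOn_ratioDeriv.continuousAt
      (Ioi_mem_nhds (p2_pos hy.1))) (continuousAt_p2 hy.1)) h'
  exact (ContinuousLinearMap.toSpanSingletonCLE (𝕜 := ℝ) (E := ℝ)).continuous.continuousAt.comp hc

/-- Slopes of p₂ are reciprocals of slopes of `ratio`, which tend to 0 through positive values. -/
lemma derivEqTop_p2 {m : ℝ} (hm : m ∈ Ioo (0 : ℝ) 1) (h : cos (phase (p2 m)) = 0) :
    DerivEqTop p2 m := by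
  have hp := p2_pos hm
  have h0 : ratioDeriv (p2 m) = 0 := (ratioDeriv_eq_zero_iff hp).2 h
  have hslope : Tendsto (slope ratio (p2 m)) (𝓝[≠] (p2 m)) (𝓝[>] 0) := by
    refine tendsto_nhdsWithin_iff.2 ⟨?_, ?_⟩
    · have := hasDerivAt_iff_tendsto_slope.1 (hasDerivAt_ratio hp)
      rwa [h0] at this
    · filter_upwards [self_mem_nhdsWithin, mem_nhdsWithin_of_mem_nhds (Ioi_mem_nhds hp)] with y hy hy0
      rw [slope_def_field]
      rcases lt_or_gt_of_ne hy with h | h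
      · exact div_pos_of_neg_of_neg (sub_neg.2 (strictMonoOn_ratio hy0 hp h)) (sub_neg.2 h)
      · exact div_pos (sub_pos.2 (strictMonoOn_ratio hp hy0 h)) (sub_pos.2 h)
  have hp2 : Tendsto p2 (𝓝[≠] m) (𝓝[≠] (p2 m)) := by
    refine tendsto_nhdsWithin_iff.2
      ⟨(continuousAt_p2 hm).tendsto.mono_left nhdsWithin_le_nhds, ?_⟩
    filter_upwards [self_mem_nhdsWithin, mem_nhdsWithin_of_mem_nhds (Ioo_mem_nhds hm.1 hm.2)]
      with y hy hy0 heq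
    exact hy (strictMonoOn_p2.injOn hy0 hm heq)
  refine (tendsto_inv_nhdsGT_zero.comp (hslope.comp hp2)).congr' ?_
  filter_upwards [mem_nhdsWithin_of_mem_nhds (Ioo_mem_nhds hm.1 hm.2)] with y hy
  simp only [Function.comp, slope_def_field, ratio_p2 hy, ratio_p2 hm, inv_div]

lemma changesSignAt_p2 {m : ℝ} (hm : m ∈ Ioo (0 : ℝ) 1) :
    (∀ᶠ y in 𝓝[<] p2 m, g2 y m < 0) ∧ (∀ᶠ y in 𝓝[>] p2 m, 0 < g2 y m) := by
  have hp := p2_pos hm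
  constructor
  · filter_upwards [self_mem_nhdsWithin, mem_nhdsWithin_of_mem_nhds (Ioi_mem_nhds hp)] with y hy hy0
    exact g2_neg hy0 hm.1 hm.2 ((lt_p2_iff hm hy0).1 hy)
  · have hq : p2 m / m = next (p2 m) := by
      conv_lhs => rw [← ratio_p2 hm, p2_ratio hp, ratio]
      have := (next_pos hp).ne'
      field_simp
    have hc : ContinuousAt (fun y => phase (y / m)) (p2 m) :=
      ContinuousAt.comp (f := fun y => y / m)
        (hasDerivAt_phase (div_pos hp hm.1)).continuousAt (by fun_prop)
    have hlt : phase (p2 m / m) < phase (p2 m) + 2 * π := by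
      rw [hq, phase_next hp]
      linarith [pi_pos]
    have hev := hc.eventually_lt
      ((hasDerivAt_phase hp).continuousAt.add (continuousAt_const (y := 2 * π))) hlt
    filter_upwards [self_mem_nhdsWithin, mem_nhdsWithin_of_mem_nhds (Ioi_mem_nhds hp),
      mem_nhdsWithin_of_mem_nhds hev] with y hy hy0 hy2
    exact g2_pos hy0 hm.1 ((p2_lt_iff hm hy0).1 hy) hy2

/-! ### Position of p₂ relative to the hyperbola, for m < 1 -/

lemma hyperbola_pos {m : ℝ} (hm : m ∈ Ioo (0 : ℝ) 1) : 0 < π * m / (1 - m) :=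
  div_pos (mul_pos pi_pos hm.1) (sub_pos.2 hm.2)

lemma hyperbola_div {m : ℝ} (hm : m ∈ Ioo (0 : ℝ) 1) :
    π * m / (1 - m) / m = π * m / (1 - m) + π := by
  have h0 := hm.1.ne'
  have h1 : 1 - m ≠ 0 := (sub_pos.2 hm.2).ne'
  field_simp
  ring

lemma sq_mul_g2_hyperbola {m : ℝ} (hm : m ∈ Ioo (0 : ℝ) 1) {j : ℕ} {x : ℝ}
    (hx : π * m / (1 - m) = x + j * π) :
    (x + j * π + π) ^ 2 * g2 (x + j * π) m = π * sin x *
      ((x + j * π) * (x + j * π + π) * cos x - (2 * (x + j * π) + π) * sin x) := by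
  have hp := hyperbola_pos hm
  have hd := hyperbola_div hm
  rw [hx] at hp hd
  have h := sq_mul_g2 (p := x + j * π) (q := x + j * π + π) (by linarith [pi_pos]) hp.ne'
  have hm' : (x + j * π) / (x + j * π + π) = m := by
    rw [← hd]
    have := hm.1.ne'
    field_simp
  rw [hm'] at h
  rw [h]
  unfold bu bv
  rw [sin_add_pi, cos_add_pi, sin_add_nat_mul_pi, cos_add_nat_mul_pi]
  have h1 : ((-1 : ℝ) ^ j) ^ 2 = 1 := by rw [← pow_mul, mul_comm, pow_mul]; simp
  linear_combination (π * sin x *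
    ((x + j * π) * (x + j * π + π) * cos x - (2 * (x + j * π) + π) * sin x)) * h1

/-- The hyperbola has height rπ at m = r/(1+r). Thus `c1 k` corresponds to r = k + 1/2, and `a1 k`
to a value smaller by 1/(4(k+1)). -/
lemma a1_eq (k : ℕ) : a1 k = ((k : ℝ) + 1 / 2 - 1 / (4 * (k + 1))) /
    (1 + ((k : ℝ) + 1 / 2 - 1 / (4 * (k + 1)))) := by
  have h : (1 : ℝ) + ((k : ℝ) + 1 / 2 - 1 / (4 * (k + 1))) =
      (4 * (k : ℝ) ^ 2 + 10 * k + 5) / (4 * (k + 1)) := by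
    field_simp
    ring
  have h' : 15 + 40 * (k : ℝ) + 32 * (k : ℝ) ^ 2 + 8 * (k : ℝ) ^ 3 =
      (3 + 2 * k) * (4 * (k : ℝ) ^ 2 + 10 * k + 5) := by ring
  rw [h, a1, c1, h']
  field_simp
  ring

lemma c1_lt_one (k : ℕ) : c1 k < 1 := by
  rw [c1, div_lt_one (by positivity)]
  linarith

lemma a1_lt_c1 (k : ℕ) : a1 k < c1 k := by
  rw [a1]
  have : 0 < 2 / (15 + 40 * (k : ℝ) + 32 * (k : ℝ) ^ 2 + 8 * (k : ℝ) ^ 3) := by positivity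
  linarith

lemma lt_a1 {k : ℕ} : (k : ℝ) / (1 + k) < a1 k := by
  have h : 0 < 1 / 2 - 1 / (4 * ((k : ℝ) + 1)) := by
    rw [sub_pos, div_lt_div_iff₀ (by positivity) (by positivity)]
    linarith [k.cast_nonneg (α := ℝ)]
  have hk := k.cast_nonneg (α := ℝ)
  rw [a1_eq, div_lt_div_iff₀ (by positivity) (by linarith)]
  nlinarith

lemma lt_c1 {k : ℕ} : (k : ℝ) / (1 + k) < c1 k := lt_a1.trans (a1_lt_c1 k)

/-- Position of the hyperbola relative to `kπ`. -/
lemma mul_pi_lt_hyperbola {r m : ℝ} (hr : 0 ≤ r) (hm : m ∈ Ioo (0 : ℝ) 1) (h : r / (1 + r) < m) :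
    r * π < π * m / (1 - m) := by
  rw [div_lt_iff₀ (by positivity)] at h
  rw [lt_div_iff₀ (sub_pos.2 hm.2)]
  nlinarith [pi_pos]

lemma mul_pi_le_hyperbola {r m : ℝ} (hr : 0 ≤ r) (hm : m ∈ Ioo (0 : ℝ) 1) (h : r / (1 + r) ≤ m) :
    r * π ≤ π * m / (1 - m) := by
  rw [div_le_iff₀ (by positivity)] at h
  rw [le_div_iff₀ (sub_pos.2 hm.2)]
  nlinarith [pi_pos]

lemma hyperbola_lt_mul_pi {r m : ℝ} (hr : 0 ≤ r) (hm : m ∈ Ioo (0 : ℝ) 1) (h : m < r / (1 + r)) :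
    π * m / (1 - m) < r * π := by
  rw [lt_div_iff₀ (by positivity)] at h
  rw [div_lt_iff₀ (sub_pos.2 hm.2)]
  nlinarith [pi_pos]

lemma hyperbola_le_mul_pi {r m : ℝ} (hr : 0 ≤ r) (hm : m ∈ Ioo (0 : ℝ) 1) (h : m ≤ r / (1 + r)) :
    π * m / (1 - m) ≤ r * π := by
  rw [le_div_iff₀ (by positivity)] at h
  rw [div_le_iff₀ (sub_pos.2 hm.2)]
  nlinarith [pi_pos]

lemma p2_lt_hyperbola {k : ℕ} (hk : 1 ≤ k) {m : ℝ} (h1 : (k : ℝ) / (1 + k) < m)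
    (h2 : m ≤ a1 k) : p2 m < π * m / (1 - m) := by
  have hm : m ∈ Ioo (0 : ℝ) 1 :=
    ⟨lt_of_le_of_lt (by positivity) h1, h2.trans_lt ((a1_lt_c1 k).trans (c1_lt_one k))⟩
  have hk' : (1 : ℝ) ≤ k := by exact_mod_cast hk
  have hr0 : 1 / (4 * ((k : ℝ) + 1)) ≤ 1 / 8 := by
    rw [div_le_div_iff₀ (by positivity) (by positivity)]
    linarith
  rw [a1_eq] at h2
  have hl := mul_pi_lt_hyperbola (by positivity) hm h1
  have hu := hyperbola_le_mul_pi (by linarith) hm h2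
  have hp := hyperbola_pos hm
  refine p2_lt_of_g2_pos hm hp ?_
  -- y is the distance below height (k + 1/2)π. By `sq_mul_g2_hyperbola` the aim is (2p + π) cos y <
  -- p(p + π) sin y, and y cos y < sin y reduces it to `key`.
  set y := ((k : ℝ) + 1 / 2) * π - π * m / (1 - m) with hy
  have hx : π * m / (1 - m) = (π / 2 - y) + k * π := by rw [hy]; ring
  have hg := sq_mul_g2_hyperbola hm hx
  have hy0 : 1 / (4 * ((k : ℝ) + 1)) * π ≤ y := by rw [hy]; linarith
  have hy1 : y < π / 2 := by rw [hy]; linarith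
  have hypos : 0 < y := lt_of_lt_of_le (by positivity) hy0
  have hc : 0 < cos y := cos_pos_of_mem_Ioo ⟨by linarith, hy1⟩
  have hs : y * cos y < sin y := sub_pos.1 (bu_pos hypos (by linarith [pi_pos]))
  rw [sin_pi_div_two_sub, cos_pi_div_two_sub, ← hx] at hg
  set p := π * m / (1 - m) with hpdef
  set n := (k : ℝ) + 1 with hn
  have hn2 : 2 ≤ n := by linarith
  have hz : p + π / 2 = n * π - y := by rw [hx, hn]; ring
  set z := p + π / 2 with hzdef
  have hz1 : 3 * π / 2 ≤ z := by nlinarith [pi_pos]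
  have hny : π ≤ 4 * n * y := by
    have h : 4 * n * (1 / (4 * n) * π) = π := by field_simp
    have := mul_le_mul_of_nonneg_left hy0 (show 0 ≤ 4 * n by positivity)
    linarith
  have hyz : 15 / 64 * π ^ 2 ≤ y * z := by
    have h1 : y * z = n * y * π - y ^ 2 := by rw [hz]; ring
    rw [h1]
    -- For small y use 4ny ≥ π; for large y use n ≥ 2 and the concavity of 2πy - y². Both give
    -- 15π²/64 at y = π/8.
    rcases le_or_gt y (π / 8) with h8 | h8
    · have h3 : y ^ 2 ≤ (π / 8) ^ 2 := by gcongr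
      have h4 := mul_le_mul_of_nonneg_right hny pi_pos.le
      linarith
    · have h3 := mul_le_mul_of_nonneg_right hn2 (mul_pos hypos pi_pos).le
      have h4 := mul_nonneg (sub_nonneg.2 h8.le) (show 0 ≤ 15 * π / 8 - y by linarith [pi_pos])
      linarith
  -- Exactly what is needed, as 8/9 · 15/64 · 9.6 = 2.
  have hππ : 9.6 < π ^ 2 := by nlinarith [pi_gt_d2]
  have hzz : 8 / 9 * z ^ 2 ≤ z ^ 2 - π ^ 2 / 4 := by
    have : (3 * π / 2) ^ 2 ≤ z ^ 2 := by gcongr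
    linarith
  have hz0 : 0 < z := by linarith [pi_pos]
  have key : 2 * z < y * (z ^ 2 - π ^ 2 / 4) := by
    have h1 : y * (8 / 9 * z ^ 2) ≤ y * (z ^ 2 - π ^ 2 / 4) :=
      mul_le_mul_of_nonneg_left hzz hypos.le
    have h2 : 2 * z < 8 / 9 * (y * z) * z := by
      apply mul_lt_mul_of_pos_right _ hz0
      linarith
    calc 2 * z < 8 / 9 * (y * z) * z := h2
      _ = y * (8 / 9 * z ^ 2) := by ring
      _ ≤ _ := h1
  have hpq : p * (p + π) = z ^ 2 - π ^ 2 / 4 := by rw [hzdef]; ring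
  have h3 : (2 * p + π) * cos y < p * (p + π) * sin y := by
    calc (2 * p + π) * cos y = 2 * z * cos y := by rw [hzdef]; ring
      _ < y * (z ^ 2 - π ^ 2 / 4) * cos y := mul_lt_mul_of_pos_right key hc
      _ = p * (p + π) * (y * cos y) := by rw [hpq]; ring
      _ < p * (p + π) * sin y := mul_lt_mul_of_pos_left hs (by positivity)
  have h4 : 0 < (p + π) ^ 2 * g2 p m := by
    rw [hg]
    exact mul_pos (mul_pos pi_pos hc) (sub_pos.2 h3)
  exact pos_of_mul_pos_right h4 (by positivity)

lemma hyperbola_lt_p2 {k : ℕ} {m : ℝ} (h1 : c1 k ≤ m)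
    (h2 : m < (1 + (k : ℝ)) / (2 + k)) : π * m / (1 - m) < p2 m := by
  have hm : m ∈ Ioo (0 : ℝ) 1 := by
    refine ⟨lt_of_lt_of_le (by unfold c1; positivity) h1, h2.trans ?_⟩
    rw [div_lt_one (by positivity)]
    linarith
  have hl := mul_pi_le_hyperbola (r := k + 1 / 2) (by positivity) hm (by
    refine le_trans (le_of_eq ?_) h1
    unfold c1
    rw [div_eq_div_iff (by positivity) (by positivity)]
    ring)
  have hu := hyperbola_lt_mul_pi (r := k + 1) (by positivity) hm (by
    refine lt_of_lt_of_eq h2 ?_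
    rw [div_eq_div_iff (by positivity) (by positivity)]
    ring)
  have hp := hyperbola_pos hm
  refine lt_p2_of_g2_neg hm hp ?_ ?_
  · set x := π * m / (1 - m) - k * π with hxdef
    have hx : π * m / (1 - m) = x + k * π := by rw [hxdef]; ring
    have hg := sq_mul_g2_hyperbola hm hx
    rw [← hx] at hg
    have hx1 : π / 2 ≤ x := by rw [hxdef]; linarith
    have hx2 : x < π := by rw [hxdef]; linarith
    have hs : 0 < sin x := sin_pos_of_pos_of_lt_pi (by linarith [pi_pos]) hx2
    have hc : cos x ≤ 0 := cos_nonpos_of_pi_div_two_le_of_le hx1 (by linarith)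
    set p := π * m / (1 - m)
    have h4 : (p + π) ^ 2 * g2 p m < 0 := by
      rw [hg]
      refine mul_neg_of_pos_of_neg (mul_pos pi_pos hs) ?_
      have h5 : p * (p + π) * cos x ≤ 0 := mul_nonpos_of_nonneg_of_nonpos (by positivity) hc
      have h6 : 0 < (2 * p + π) * sin x := mul_pos (by positivity) hs
      linarith
    exact neg_of_mul_neg_right h4 (by positivity)
  · rw [hyperbola_div hm]
    exact phase_add_pi_lt hp

lemma p2_div_add_one {k : ℕ} (hk : 1 ≤ k) : p2 ((k : ℝ) / (k + 1)) = k * π := by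
  obtain ⟨j, rfl⟩ := Nat.exists_eq_add_of_le' hk
  push_cast
  rw [show ((j : ℝ) + 1) / (j + 1 + 1) = ratio ((j + 1) * π) by rw [ratio_mul_pi]; ring]
  exact p2_ratio (by positivity)

/-! ### Points of infinite derivative, smoothness elsewhere, and m* -/

/-- The zero of `tan x - x` in `(kπ, (k + 1/2)π)`, characterized by the phase. -/
lemma exists_phase_eq {k : ℕ} (hk : 1 ≤ k) :
    ∃ l, k * π < l ∧ l < (k + 1 / 2) * π ∧ phase l = (k - 1 / 2) * π := by
  obtain ⟨j, rfl⟩ := Nat.exists_eq_add_of_le' hk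
  push_cast
  have hπ := pi_pos
  have ha : 0 < ((j : ℝ) + 1) * π := by positivity
  have hb : 0 < ((j : ℝ) + 1 + 1 / 2) * π := by positivity
  have hc : 0 < ((j : ℝ) + 1 + 1) * π := by positivity
  have hab : ((j : ℝ) + 1) * π < (j + 1 + 1 / 2) * π := by nlinarith
  have h1 := phase_add_one_mul_pi j
  have h2 := phase_add_one_mul_pi (j + 1)
  push_cast at h2
  have h3 := strictMonoOn_phase ha hb hab
  have h4 := strictMonoOn_phase hb hc (by nlinarith)
  rw [h1] at h3
  rw [h2] at h4
  -- At (j + 3/2)π, `bu` equals the sine, whose sign puts the angle past the midpoint of [jπ,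
  -- (j+1)π].
  have h5 : (j + 1 - 1 / 2) * π < phase ((j + 1 + 1 / 2) * π) := by
    obtain ⟨r, hr, hu, -⟩ := exists_polar hb
    set t := phase ((j + 1 + 1 / 2) * π) - j * π with ht
    have ht' : phase ((j + 1 + 1 / 2) * π) = t + j * π := by rw [ht]; ring
    have hbu : bu ((j + 1 + 1 / 2) * π) = -(-1) ^ j := by
      rw [bu, show ((j : ℝ) + 1 + 1 / 2) * π = π / 2 + (j + 1 : ℕ) * π by push_cast; ring,
        sin_add_nat_mul_pi, cos_add_nat_mul_pi]
      simp [pow_succ]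
    rw [hbu, ht', cos_add_nat_mul_pi] at hu
    have h6 : ((-1 : ℝ) ^ j) ^ 2 = 1 := by rw [← pow_mul, mul_comm, pow_mul]; simp
    have h7 : r * cos t = -1 := by
      linear_combination (r * cos t - (-1)) * (-h6) + (-(-1) ^ j) * hu
    by_contra! h8
    have : 0 ≤ cos t := cos_nonneg_of_mem_Icc ⟨by linarith, by linarith⟩
    nlinarith
  obtain ⟨l, hl, hl0⟩ := intermediate_value_Ioo hab.le
    (continuousOn_phase.mono fun y hy => ha.trans_le hy.1)
    (show (j + 1 - 1 / 2) * π ∈ Ioo _ _ from ⟨by rw [h1]; nlinarith, h5⟩)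
  exact ⟨l, hl.1, hl.2, hl0⟩

lemma c1_mem (k : ℕ) : c1 k ∈ Ioo (0 : ℝ) 1 := ⟨by unfold c1; positivity, c1_lt_one k⟩

lemma c1_lt (k : ℕ) : c1 k < (1 + (k : ℝ)) / (2 + k) := by
  rw [c1, div_lt_div_iff₀ (by positivity) (by positivity)]
  nlinarith

/-- The point with infinite derivative, and its position. -/
lemma exists_infinite_deriv {k : ℕ} (hk : 1 ≤ k) :
    ∃ m, a1 k < m ∧ m < c1 k ∧ phase (p2 m) = (k - 1 / 2) * π ∧ π * m / (1 - m) < p2 m := by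
  obtain ⟨l, hl1, hl2, hl⟩ := exists_phase_eq hk
  have hk' : (1 : ℝ) ≤ k := by exact_mod_cast hk
  have hkπ : 0 < k * π := by positivity
  have hl0 : 0 < l := hkπ.trans hl1
  have hp2 := p2_ratio hl0
  have hm := ratio_mem hl0
  have hcos : cos (phase l) = 0 := by
    obtain ⟨j, rfl⟩ := Nat.exists_eq_add_of_le' hk
    rw [hl, show (((j + 1 : ℕ) : ℝ) - 1 / 2) * π = π / 2 + j * π by push_cast; ring,
      cos_add_nat_mul_pi]
    simp
  -- At height l on the hyperbola q = l + π. Since `bu l = 0`, the determinant is -π l³ cos² l < 0,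
  -- so p₂ lies above l there and `ratio l` is smaller than the hyperbola's abscissa.
  have hyp : π * ratio l / (1 - ratio l) < l := by
    have hlπ : 0 < l + π := by linarith [pi_pos]
    have hm' : l / (l + π) ∈ Ioo (0 : ℝ) 1 :=
      ⟨by positivity, (div_lt_one hlπ).2 (by linarith [pi_pos])⟩
    have hdiv : l / (l / (l + π)) = l + π := by field_simp
    have hg : g2 l (l / (l + π)) < 0 := by
      have h := sq_mul_g2 hlπ.ne' hl0.ne'
      obtain ⟨r, hr, hu, hv⟩ := exists_polar hl0
      have hpos := bu_sq_add_bv_sq_pos hl0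
      rw [hcos, mul_zero] at hu
      have hs : sin l = l * cos l := sub_eq_zero.1 hu
      have hc : cos l ≠ 0 := fun hc => by
        rw [hu, bv, hs, hc] at hpos
        simp at hpos
      have h1 : bu (l + π) = π * cos l := by
        rw [bu, sin_add_pi, cos_add_pi, hs]
        ring
      rw [hu, h1, bv, bv, hs] at h
      have h2 : (l + π) ^ 2 * g2 l (l / (l + π)) < 0 := by
        rw [h]
        have : 0 < l ^ 3 * π * cos l ^ 2 := by positivity
        linarith
      exact neg_of_mul_neg_right h2 (by positivity)
    have h1 := lt_p2_of_g2_neg hm' hl0 hg (by rw [hdiv]; exact phase_add_pi_lt hl0)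
    have h2 := (lt_p2_iff hm' hl0).1 h1
    rw [lt_div_iff₀ hlπ] at h2
    rw [div_lt_iff₀ (sub_pos.2 hm.2)]
    linarith
  have hlow : (k : ℝ) / (1 + k) < ratio l := by
    have hmk : (k : ℝ) / (1 + k) ∈ Ioo (0 : ℝ) 1 :=
      ⟨by positivity, (div_lt_one (by positivity)).2 (by linarith)⟩
    rw [← p2_lt_iff hmk hl0, add_comm, p2_div_add_one hk]
    exact hl1
  refine ⟨ratio l, ?_, ?_, by rw [hp2, hl], by rwa [hp2]⟩
  · by_contra! h
    have := p2_lt_hyperbola hk hlow h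
    rw [hp2] at this
    linarith
  · rw [← lt_p2_iff (c1_mem k) hl0]
    refine hl2.trans (lt_of_eq_of_lt ?_ (hyperbola_lt_p2 le_rfl (c1_lt k)))
    have : 1 - c1 k ≠ 0 := (sub_pos.2 (c1_lt_one k)).ne'
    rw [eq_div_iff this, c1]
    field_simp
    ring

lemma cos_ne_zero_of_shift {j : ℕ} {φ : ℝ} (h1 : j * π ≤ φ) (h2 : φ ≤ (j + 1) * π)
    (h : φ ≠ (j + 1 / 2) * π) : cos φ ≠ 0 := by
  have h3 : φ = (φ - j * π) + j * π := by ring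
  rw [h3, cos_add_nat_mul_pi]
  refine mul_ne_zero (pow_ne_zero _ (by norm_num)) ?_
  rcases lt_or_gt_of_ne h with h | h
  · exact (cos_pos_of_mem_Ioo ⟨by linarith [pi_pos], by linarith⟩).ne'
  · exact (cos_neg_of_pi_div_two_lt_of_lt (by linarith) (by linarith [pi_pos])).ne

/-- From k/(k+1) to (k+1)/(k+2) the phase of p₂ rises from (k-1)π to kπ, so its cosine vanishes
once, at the singular point, which lies strictly between `a1 k` and `c1 k`. -/
lemma contDiffAt_p2_of_mem {k : ℕ} (hk : 1 ≤ k) {m : ℝ}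
    (h : m ∈ Icc ((k : ℝ) / (1 + k)) (a1 k) ∪ Icc (c1 k) ((1 + (k : ℝ)) / (2 + k))) :
    ContDiffAt ℝ 1 p2 m := by
  obtain ⟨mb, hb1, hb2, hb, -⟩ := exists_infinite_deriv hk
  have hk' : (1 : ℝ) ≤ k := by exact_mod_cast hk
  have hle : (k : ℝ) / (1 + k) ≤ m := by
    rcases h with h | h
    · exact h.1
    · exact lt_c1.le.trans h.1
  have hge : m ≤ (1 + (k : ℝ)) / (2 + k) := by
    rcases h with h | h
    · exact h.2.trans ((a1_lt_c1 k).trans (c1_lt k)).le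
    · exact h.2
  have hne : m ≠ mb := by
    rintro rfl
    rcases h with h | h
    · exact hb1.not_ge h.2
    · exact hb2.not_ge h.1
  have hM : (1 + (k : ℝ)) / (2 + k) ∈ Ioo (0 : ℝ) 1 :=
    ⟨by positivity, (div_lt_one (by positivity)).2 (by linarith)⟩
  have hm : m ∈ Ioo (0 : ℝ) 1 := ⟨lt_of_lt_of_le (by positivity) hle, hge.trans_lt hM.2⟩
  have hmk : (k : ℝ) / (1 + k) ∈ Ioo (0 : ℝ) 1 :=
    ⟨by positivity, (div_lt_one (by positivity)).2 (by linarith)⟩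
  have hmb : mb ∈ Ioo (0 : ℝ) 1 :=
    ⟨lt_of_le_of_lt (by positivity) (lt_a1.trans hb1), hb2.trans (c1_lt_one k)⟩
  refine contDiffAt_p2 hm ?_
  have h1 := strictMonoOn_p2.monotoneOn hmk hm hle
  have h2 := strictMonoOn_p2.monotoneOn hm hM hge
  have h3 := p2_div_add_one hk
  have h4 := p2_div_add_one (k := k + 1) (by omega)
  push_cast at h4
  rw [add_comm, h3] at h1
  rw [show (1 + (k : ℝ)) / (2 + k) = (k + 1) / (k + 1 + 1) by ring, h4] at h2
  have h5 := strictMonoOn_phase.monotoneOn (show 0 < k * π by positivity) (p2_pos hm) h1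
  have h6 := strictMonoOn_phase.monotoneOn (p2_pos hm) (show 0 < ((k : ℝ) + 1) * π by positivity) h2
  rw [phase_add_one_mul_pi] at h6
  have h7 : phase (p2 m) ≠ (k - 1 / 2) * π := by
    rw [← hb]
    exact fun h => hne (strictMonoOn_p2.injOn hm hmb
      (strictMonoOn_phase.injOn (p2_pos hm) (p2_pos hmb) h))
  obtain ⟨j, rfl⟩ := Nat.exists_eq_add_of_le' hk
  push_cast at h5 h6 h7
  rw [phase_add_one_mul_pi] at h5
  exact cos_ne_zero_of_shift h5 h6 fun h => h7 (h.trans (by ring))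

lemma p2_half : p2 (1 / 2) = π := by
  have := p2_div_add_one (k := 1) le_rfl
  norm_num at this ⊢
  exact this

lemma contDiffAt_p2_of_lt_half {m : ℝ} (h0 : 0 < m) (h : m < 1 / 2) : ContDiffAt ℝ 1 p2 m := by
  have hm : m ∈ Ioo (0 : ℝ) 1 := ⟨h0, by linarith⟩
  have h1 := strictMonoOn_p2 hm (show (1 / 2 : ℝ) ∈ Ioo (0 : ℝ) 1 by norm_num) h
  rw [p2_half] at h1
  refine contDiffAt_p2 hm fun hc => ?_
  obtain ⟨r, hr, hu, -⟩ := exists_polar (p2_pos hm)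
  rw [hc, mul_zero] at hu
  exact (bu_pos (p2_pos hm) h1).ne' hu

lemma exists_mstar_mbar {k : ℕ} (hk : 1 ≤ k) : ∃ mstar mbar : ℝ,
    a1 k < mstar ∧ mstar < mbar ∧ mbar < c1 k ∧ p2 mstar = π * mstar / (1 - mstar) ∧
    DerivEqTop p2 mbar := by
  obtain ⟨mb, hb1, hb2, hb, hb3⟩ := exists_infinite_deriv hk
  have hpos : 0 < a1 k := lt_of_le_of_lt (by positivity) (lt_a1 (k := k))
  have hmem : ∀ m ∈ Icc (a1 k) mb, m ∈ Ioo (0 : ℝ) 1 := fun m hm =>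
    ⟨hpos.trans_le hm.1, hm.2.trans_lt (hb2.trans (c1_lt_one k))⟩
  have hc : ContinuousOn (fun m => p2 m - π * m / (1 - m)) (Icc (a1 k) mb) := by
    refine ContinuousOn.sub (fun m hm => (continuousAt_p2 (hmem m hm)).continuousWithinAt)
      (ContinuousOn.div (by fun_prop) (by fun_prop) fun m hm => (sub_pos.2 (hmem m hm).2).ne')
  -- p₂ is below the hyperbola at `a1 k` and above it at the singular point.
  obtain ⟨ms, hms, h0⟩ := intermediate_value_Ioo hb1.le hc
    (show (0 : ℝ) ∈ Ioo _ _ from ⟨sub_neg.2 (p2_lt_hyperbola hk lt_a1 le_rfl), sub_pos.2 hb3⟩)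
  refine ⟨ms, mb, hms.1, hms.2, hb2, sub_eq_zero.1 h0,
    derivEqTop_p2 (hmem mb (right_mem_Icc.2 hb1.le)) ?_⟩
  obtain ⟨j, rfl⟩ := Nat.exists_eq_add_of_le' hk
  rw [hb, show (((j + 1 : ℕ) : ℝ) - 1 / 2) * π = π / 2 + j * π by push_cast; ring,
    cos_add_nat_mul_pi]
  simp

/-! ### Bounds for m < 1/2: test points q = 2π and q = 5.7 -/

lemma p2_lt_two_pi_mul {m : ℝ} (h0 : 0 < m) (h : m < 1 / 2) : p2 m < 2 * π * m := by
  have hm : m ∈ Ioo (0 : ℝ) 1 := ⟨h0, by linarith⟩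
  have hπ := pi_pos
  have hp : 0 < 2 * π * m := by positivity
  rw [p2_lt_iff hm hp, lt_ratio_iff hp h0, show 2 * π * m / m = (1 + 1) * π by field_simp; norm_num]
  have h1 := phase_add_one_mul_pi 1
  push_cast at h1
  rw [h1]
  have := strictMonoOn_phase hp pi_pos (by nlinarith)
  rw [phase_pi] at this
  linarith

lemma mul_lt_p2 {m : ℝ} (h0 : 0 < m) (h : m < 1 / 2) : 5.7 * m < p2 m := by
  have hm : m ∈ Ioo (0 : ℝ) 1 := ⟨h0, by linarith⟩
  have hπ1 := pi_gt_d4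
  have hπ2 := pi_lt_d4
  have hp : 0 < 5.7 * m := by positivity
  have hpπ : 5.7 * m < π := by linarith
  have hdiv : 5.7 * m / m = 5.7 := by field_simp
  refine lt_p2_of_g2_neg hm hp ?_ ?_
  · have hg := sq_mul_g2 (p := 5.7 * m) (q := 5.7) (by norm_num) hp.ne'
    rw [show 5.7 * m / 5.7 = m by field_simp] at hg
    set y := 2 * π - 5.7 with hy
    have hy0 : 0.583 < y := by rw [hy]; linarith
    have hy1 : y < π / 2 := by rw [hy]; linarith
    have hsy : 0 < sin y := sin_pos_of_pos_of_lt_pi (by linarith) (by linarith)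
    have hcy : 0 < cos y := cos_pos_of_mem_Ioo ⟨by linarith, hy1⟩
    have hyy : y * cos y < sin y := sub_pos.1 (bu_pos (by linarith) (by linarith))
    have h57 : (5.7 : ℝ) = 2 * π - y := by rw [hy]; ring
    have hs : sin 5.7 = -sin y := by rw [h57, sin_two_pi_sub]
    have hc : cos 5.7 = cos y := by rw [h57, cos_two_pi_sub]
    have hv : bv 5.7 < 0 := by rw [bv, hs]; nlinarith
    -- Uses tan y > y > 0.583 and 0.583 · (5.7²/3 - 1) > 5.7. With `bv p / 3 < bu p` and `bv 5.7 <
    -- 0` it makes the determinant negative.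
    have hu : bv 5.7 / 3 ≤ bu 5.7 := by
      rw [bv, bu, hs, hc]
      nlinarith
    have hvp : 0 < bv (5.7 * m) :=
      mul_pos (by positivity) (sin_pos_of_pos_of_lt_pi hp hpπ)
    have h3 := bv_div_three_lt_bu hp hpπ
    have h4 : (5.7 : ℝ) ^ 2 * g2 (5.7 * m) m < 0 := by
      rw [hg]
      nlinarith
    exact neg_of_mul_neg_right h4 (by positivity)
  · rw [hdiv]
    have h1 := phase_add_one_mul_pi 1
    push_cast at h1
    have h2 := strictMonoOn_phase (show (0 : ℝ) < 5.7 by norm_num)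
      (show 0 < (1 + 1) * π by positivity) (by linarith)
    rw [h1] at h2
    linarith [neg_pi_lt_phase hp]

/-! ### Bounds for 1/2 ≤ m < 1: test points on a ray -/

lemma two_mul_cross (p q : ℝ) : 2 * (bu p * bv q - bv p * bu q) =
    -(p * q) * ((q - p) * sin (p + q) + (p + q) * sin (q - p)) +
      (q ^ 2 - p ^ 2) * (cos (q - p) - cos (p + q)) := by
  unfold bu bv
  rw [sin_add, sin_sub, cos_add, cos_sub]
  ring

/-- `g2` along the ray of slope `(1 - μ) / (1 + μ)`, in terms of the difference `μ s` and the
sum `s` of `p / m` and `p`. -/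
lemma g2_ray {μ s : ℝ} (hμ : 0 < μ) (hμ1 : μ < 1) (hs : 0 < s) :
    ((1 + μ) * s / 2) ^ 2 * g2 ((1 - μ) * s / 2) ((1 - μ) / (1 + μ)) * 2 =
      s ^ 2 * (μ * (cos (μ * s) - cos s) -
        (1 - μ ^ 2) * s / 4 * (μ * sin s + sin (μ * s))) := by
  have h1 : 0 < 1 - μ := by linarith
  have h := sq_mul_g2 (p := (1 - μ) * s / 2) (q := (1 + μ) * s / 2) (by positivity) (by positivity)
  rw [show (1 - μ) * s / 2 / ((1 + μ) * s / 2) = (1 - μ) / (1 + μ) by field_simp] at h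
  rw [h, mul_comm _ (2 : ℝ), two_mul_cross, show (1 - μ) * s / 2 + (1 + μ) * s / 2 = s by ring,
    show (1 + μ) * s / 2 - (1 - μ) * s / 2 = μ * s by ring]
  ring

/-- The choice of μs gives sin(μs) = μ, so μ factors out of the bracket in `g2_ray`, leaving
-√(1-μ²) - cos s - a(1 + sin s) with a = (1-μ²)s/4 ≥ 1. -/
lemma ray_lower {μ s : ℝ} (hμ : 0 < μ) (hμ1 : μ ≤ 1 / 3) (hs : μ * s = π - arcsin μ) :
    g2 ((1 - μ) * s / 2) ((1 - μ) / (1 + μ)) < 0 := by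
  have hπ := pi_gt_d2
  have hle := arcsin_le_pi_div_two μ
  have hs0 : 0 < s := pos_of_mul_pos_right (by rw [hs]; linarith) hμ.le
  have hg := g2_ray hμ (by linarith) hs0
  rw [hs, sin_pi_sub, cos_pi_sub, sin_arcsin (by linarith) (by linarith), cos_arcsin] at hg
  have hc : 1 / 2 < √(1 - μ ^ 2) := by
    rw [lt_sqrt (by norm_num)]
    nlinarith
  have ha : 1 ≤ (1 - μ ^ 2) * s / 4 := by
    have h1 : 3 * (π / 2) ≤ s := by nlinarith
    have h2 : 8 / 9 ≤ 1 - μ ^ 2 := by nlinarith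
    nlinarith
  have h3 := sin_sq_add_cos_sq s
  have h4 := neg_one_le_sin s
  -- This is (1 + cos s)² + (1 + sin s)² ≥ 0; the spare 1/2 is beaten by √(1-μ²).
  have h5 : -cos s ≤ 1 + sin s + 1 / 2 := by nlinarith [sq_nonneg (cos s + 1), sq_nonneg (1 + sin s)]
  have h6 : 1 + sin s ≤ (1 - μ ^ 2) * s / 4 * (1 + sin s) :=
    le_mul_of_one_le_left (by linarith) ha
  have h7 : ((1 + μ) * s / 2) ^ 2 * g2 ((1 - μ) * s / 2) ((1 - μ) / (1 + μ)) * 2 < 0 := by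
    rw [hg]
    refine mul_neg_of_pos_of_neg (by positivity) ?_
    have h8 : μ * (-√(1 - μ ^ 2) - cos s) - (1 - μ ^ 2) * s / 4 * (μ * sin s + μ) =
      μ * (-√(1 - μ ^ 2) - cos s - (1 - μ ^ 2) * s / 4 * (1 + sin s)) := by ring
    rw [h8]
    exact mul_neg_of_pos_of_neg hμ (by linarith)
  exact neg_of_mul_neg_right (neg_of_mul_neg_left h7 (by norm_num)) (by positivity)

lemma ray_upper {μ s : ℝ} (hμ : 0 < μ) (hμ1 : μ ≤ 1 / 3) (hs : μ * s = π + μ / (1 - 2 * μ)) :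
    0 < g2 ((1 - μ) * s / 2) ((1 - μ) / (1 + μ)) := by
  have hπ := pi_gt_d2
  have h12 : 0 < 1 - 2 * μ := by linarith
  set φ := μ / (1 - 2 * μ) with hφ
  have hφ0 : 0 < φ := by positivity
  have hφμ : φ = μ + 2 * μ * φ := by
    have : φ * (1 - 2 * μ) = μ := div_mul_cancel₀ μ h12.ne'
    linarith
  have hφ3 : φ ≤ 3 * μ := by nlinarith
  have hs0 : 0 < s := pos_of_mul_pos_right (by rw [hs]; linarith) hμ.le
  have hg := g2_ray hμ (by linarith) hs0
  rw [hs, add_comm π, sin_add_pi, cos_add_pi] at hg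
  set a := (1 - μ ^ 2) * s / 4 with ha
  have h2 : 8 / 9 ≤ 1 - μ ^ 2 := by nlinarith
  have haμ : 1 ≤ 1.44 * (μ * a) := by
    have : μ * a = (1 - μ ^ 2) * (μ * s) / 4 := by rw [ha]; ring
    rw [this, hs]
    nlinarith
  have ha0 : 0 < a := by rw [ha]; nlinarith
  -- Dividing the bracket of `g2_ray` by a leaves sin φ - μ sin s - b(cos φ + cos s), where b is of
  -- order μ².
  obtain ⟨b, hb⟩ : ∃ b, b = μ / a := ⟨_, rfl⟩
  have hb0 : 0 < b := by rw [hb]; positivity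
  have hba : μ = b * a := by rw [hb]; field_simp
  have hb2 : b ≤ 1.44 * μ ^ 2 := by
    rw [hb, div_le_iff₀ ha0]
    calc μ ≤ 1.44 * (μ * a) * μ := le_mul_of_one_le_left hμ.le haμ
      _ = 1.44 * μ ^ 2 * a := by ring
  have hsin : φ - φ ^ 3 / 6 < sin φ := sin_gt_sub_cube hφ0
  have hcube : μ + 2 * μ ^ 2 ≤ φ - φ ^ 3 / 6 := by
    have h1 : φ ^ 2 ≤ 24 * μ ^ 2 := by nlinarith
    have h2 : φ - φ ^ 3 / 6 - (μ + 2 * μ ^ 2) = φ * (24 * μ ^ 2 - φ ^ 2) / 6 := by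
      linear_combination (1 + 2 * μ) * hφμ
    have : 0 ≤ φ * (24 * μ ^ 2 - φ ^ 2) / 6 := by
      have := sub_nonneg.2 h1
      positivity
    linarith
  have hbc : b * cos s ≤ 0.36 * μ ^ 2 + μ * (1 - sin s) := by
    have h3 := sin_sq_add_cos_sq s
    have h4 : cos s ^ 2 ≤ 2 * (1 - sin s) := by nlinarith [sq_nonneg (1 - sin s)]
    have h5 : 2 * μ * (b * cos s) ≤ b ^ 2 + μ ^ 2 * cos s ^ 2 := by
      nlinarith [sq_nonneg (b - μ * cos s)]
    have h6 : b ^ 2 ≤ 2 * μ * (0.36 * μ ^ 2) := by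
      have : b ^ 2 ≤ (1.44 * μ ^ 2) ^ 2 := by gcongr
      nlinarith [pow_pos hμ 3]
    have h7 : μ ^ 2 * cos s ^ 2 ≤ μ ^ 2 * (2 * (1 - sin s)) := by gcongr
    refine le_of_mul_le_mul_left (a := 2 * μ) ?_ (by positivity)
    linarith
  have hbφ : b * cos φ ≤ 1.44 * μ ^ 2 :=
    (mul_le_of_le_one_right hb0.le (cos_le_one φ)).trans hb2
  -- The μ² budget: 2 from sin φ, against 1.44 from b cos φ and 0.36 from b cos s; the terms μ and μ
  -- sin s cancel.
  have key : 0 < sin φ - μ * sin s - b * (cos φ + cos s) := by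
    have := pow_pos hμ 2
    rw [mul_add]
    linarith
  have h7 : 0 < ((1 + μ) * s / 2) ^ 2 * g2 ((1 - μ) * s / 2) ((1 - μ) / (1 + μ)) * 2 := by
    rw [hg]
    refine mul_pos (by positivity) ?_
    have h8 : μ * (-cos φ - cos s) - a * (μ * sin s + -sin φ) =
        a * (sin φ - μ * sin s - b * (cos φ + cos s)) := by
      linear_combination (-cos φ - cos s) * hba
    rw [h8]
    exact mul_pos ha0 key
  exact pos_of_mul_pos_right (pos_of_mul_pos_left h7 (by norm_num)) (by positivity)

lemma p2_bounds {m : ℝ} (h0 : 1 / 2 ≤ m) (h1 : m < 1) :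
    π * m / (1 - m) - m / (1 - m) * arcsin ((1 - m) / (1 + m)) < p2 m ∧
      p2 m < π * m / (1 - m) + m / (3 * m - 1) := by
  have hm : m ∈ Ioo (0 : ℝ) 1 := ⟨by linarith, h1⟩
  have hm0 := hm.1
  have h1m : 0 < 1 - m := by linarith
  have h3m : 0 < 3 * m - 1 := by linarith
  have hπ := pi_pos
  set μ := (1 - m) / (1 + m) with hμ
  have hμ0 : 0 < μ := by positivity
  have hμ3 : μ ≤ 1 / 3 := by
    rw [hμ, div_le_div_iff₀ (by positivity) (by norm_num)]
    linarith
  have hmμ : (1 - μ) / (1 + μ) = m := by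
    rw [hμ]
    field_simp
    ring
  -- Here θ = μs = q - p, so the test point is p = mθ/(1-m); θ = π would be the hyperbola.
  have hθ : ∀ θ : ℝ, (1 - μ) * (θ / μ) / 2 = m / (1 - m) * θ := fun θ => by
    rw [hμ]
    field_simp
    ring
  constructor
  · have hg := ray_lower hμ0 hμ3 (s := (π - arcsin μ) / μ) (by field_simp)
    have hle := arcsin_le_pi_div_two μ
    have hp : 0 < m / (1 - m) * (π - arcsin μ) :=
      mul_pos (by positivity) (by linarith)
    rw [hmμ, hθ] at hg
    refine lt_of_eq_of_lt (by ring) (lt_p2_of_g2_neg hm hp hg ?_)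
    have h2 : m / (1 - m) * (π - arcsin μ) / m ≤ m / (1 - m) * (π - arcsin μ) + π := by
      have : m / (1 - m) * (π - arcsin μ) / m =
          m / (1 - m) * (π - arcsin μ) + (π - arcsin μ) := by
        field_simp
        ring
      rw [this]
      linarith [arcsin_nonneg.2 hμ0.le]
    exact (strictMonoOn_phase.monotoneOn (div_pos hp hm0) (add_pos hp hπ) h2).trans_lt
      (phase_add_pi_lt hp)
  · have hg := ray_upper hμ0 hμ3 (s := (π + μ / (1 - 2 * μ)) / μ) (by field_simp)
    have h12 : μ / (1 - 2 * μ) = (1 - m) / (3 * m - 1) := by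
      have : 1 - 2 * μ = (3 * m - 1) / (1 + m) := by
        rw [hμ]
        field_simp
        ring
      rw [this, hμ]
      field_simp
    rw [hmμ, hθ, h12] at hg
    have hp : 0 < m / (1 - m) * (π + (1 - m) / (3 * m - 1)) := by positivity
    refine (p2_lt_of_g2_pos hm hp hg).trans_eq ?_
    field_simp

/-! ### Transfer to m > 1 by m ↦ 1/m -/

lemma one_div_mem {m : ℝ} (hm : 1 < m) : 1 / m ∈ Ioo (0 : ℝ) 1 :=
  ⟨by positivity, (div_lt_one (by linarith)).2 hm⟩

lemma isLeast_posRoots_of_one_lt {m : ℝ} (hm : 1 < m) :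
    IsLeast (posRoots m) (m * p2 (1 / m)) := by
  have hm0 : 0 < m := by linarith
  obtain ⟨⟨h1, h2⟩, h3⟩ := isLeast_p2 (one_div_mem hm)
  refine ⟨⟨by positivity, ?_⟩, fun x hx => ?_⟩
  · rw [g2_inv hm0.ne', mul_div_cancel_left₀ _ hm0.ne', h2, mul_zero]
  · have hx2 := hx.2
    rw [g2_inv hm0.ne'] at hx2
    have h4 : g2 (x / m) (1 / m) = 0 :=
      (mul_eq_zero.1 hx2).resolve_left (neg_ne_zero.2 (by positivity))
    have h5 : p2 (1 / m) ≤ x / m := h3 ⟨div_pos hx.1 hm0, h4⟩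
    rw [le_div_iff₀ hm0] at h5
    linarith

lemma p2_eq_of_one_lt {m : ℝ} (hm : 1 < m) : p2 m = m * p2 (1 / m) :=
  (isLeast_posRoots_of_one_lt hm).csInf_eq

lemma p2_eq_mul_p2_one_div {m : ℝ} (hm : m ∈ params) : p2 m = m * p2 (1 / m) := by
  rcases hm with hm | hm
  · have hm0 := hm.1.ne'
    rw [p2_eq_of_one_lt (one_lt_one_div hm.1 hm.2), one_div_one_div]
    field_simp
  · exact p2_eq_of_one_lt hm

lemma changesSignAt_of_one_lt {m : ℝ} (hm : 1 < m) :
    ChangesSignAt (fun p => g2 p m) (p2 m) := by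
  have hm0 : 0 < m := by linarith
  obtain ⟨h1, h2⟩ := changesSignAt_p2 (one_div_mem hm)
  have hp : p2 m / m = p2 (1 / m) := by
    rw [p2_eq_of_one_lt hm, mul_div_cancel_left₀ _ hm0.ne']
  have hc : Tendsto (fun x => x / m) (𝓝 (p2 m)) (𝓝 (p2 (1 / m))) := by
    rw [← hp]
    exact tendsto_id.div_const m
  have hm2 : 0 < m ^ 2 := by positivity
  right
  constructor
  · have hl : Tendsto (fun x => x / m) (𝓝[<] p2 m) (𝓝[<] p2 (1 / m)) := by
      refine tendsto_nhdsWithin_iff.2 ⟨hc.mono_left nhdsWithin_le_nhds, ?_⟩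
      filter_upwards [self_mem_nhdsWithin] with x hx
      rw [← hp]
      exact div_lt_div_of_pos_right hx hm0
    filter_upwards [hl.eventually h1] with x hx
    rw [g2_inv hm0.ne']
    exact mul_pos_of_neg_of_neg (neg_lt_zero.2 hm2) hx
  · have hl : Tendsto (fun x => x / m) (𝓝[>] p2 m) (𝓝[>] p2 (1 / m)) := by
      refine tendsto_nhdsWithin_iff.2 ⟨hc.mono_left nhdsWithin_le_nhds, ?_⟩
      filter_upwards [self_mem_nhdsWithin] with x hx
      rw [← hp]
      exact div_lt_div_of_pos_right hx hm0
    filter_upwards [hl.eventually h2] with x hx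
    rw [g2_inv hm0.ne']
    exact mul_neg_of_neg_of_pos (neg_lt_zero.2 hm2) hx

lemma p2_eventuallyEq {m : ℝ} (hm : 1 < m) : p2 =ᶠ[𝓝 m] fun x => x * p2 (1 / x) := by
  filter_upwards [Ioi_mem_nhds hm] with x hx using p2_eq_of_one_lt hx

lemma contDiffAt_p2_of_one_div {m : ℝ} (hm : 1 < m) (h : ContDiffAt ℝ 1 p2 (1 / m)) :
    ContDiffAt ℝ 1 p2 m := by
  have hm0 : m ≠ 0 := by linarith
  have h1 : ContDiffAt ℝ 1 (fun x : ℝ => 1 / x) m := contDiffAt_const.div contDiffAt_id hm0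
  exact (contDiffAt_id.mul (ContDiffAt.comp m h h1)).congr_of_eventuallyEq (p2_eventuallyEq hm)

lemma continuousAt_p2_of_one_lt {m : ℝ} (hm : 1 < m) : ContinuousAt p2 m := by
  have hm0 : m ≠ 0 := by linarith
  have h1 : ContinuousAt (fun x : ℝ => 1 / x) m := continuousAt_const.div continuousAt_id hm0
  exact (continuousAt_id.mul (ContinuousAt.comp (f := fun x : ℝ => 1 / x)
    (continuousAt_p2 (one_div_mem hm)) h1)).congr (p2_eventuallyEq hm).symm

lemma derivEqBot_of_one_div {m : ℝ} (hm : 1 < m) (h : DerivEqTop p2 (1 / m)) :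
    DerivEqBot p2 m := by
  have hm0 : 0 < m := by linarith
  have hinv : Tendsto (fun x : ℝ => 1 / x) (𝓝 m) (𝓝 (1 / m)) :=
    tendsto_const_nhds.div tendsto_id hm0.ne'
  have hinv' : Tendsto (fun x : ℝ => 1 / x) (𝓝[≠] m) (𝓝[≠] (1 / m)) := by
    refine tendsto_nhdsWithin_iff.2 ⟨hinv.mono_left nhdsWithin_le_nhds, ?_⟩
    filter_upwards [self_mem_nhdsWithin] with x hx heq
    refine hx ?_
    have : 1 / x = 1 / m := heq
    simpa using this
  have hA : Tendsto (fun x => -(1 / x)) (𝓝[≠] m) (𝓝 (-(1 / m))) :=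
    hinv.neg.mono_left nhdsWithin_le_nhds
  have hB : Tendsto (fun x => -(1 / x) * slope p2 (1 / m) (1 / x)) (𝓝[≠] m) atBot :=
    hA.neg_mul_atTop (neg_lt_zero.2 (by positivity)) (h.comp hinv')
  have hC : Tendsto (fun x => p2 (1 / x)) (𝓝[≠] m) (𝓝 (p2 (1 / m))) :=
    ((continuousAt_p2 (one_div_mem hm)).tendsto.comp hinv).mono_left nhdsWithin_le_nhds
  -- The slope of x p₂(1/x) at m is p₂(1/x) minus 1/x times the slope of p₂ between 1/m and 1/x.
  refine (hC.add_atBot hB).congr' ?_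
  filter_upwards [self_mem_nhdsWithin, mem_nhdsWithin_of_mem_nhds (Ioi_mem_nhds hm)]
    with x hx hx1
  have hx0 : x ≠ 0 := (zero_lt_one.trans hx1).ne'
  have hxm : x - m ≠ 0 := sub_ne_zero.2 hx
  have hxm' : 1 / x - 1 / m = -(x - m) / (x * m) := by
    field_simp
    ring
  rw [slope_def_field, slope_def_field, p2_eq_of_one_lt hx1, p2_eq_of_one_lt hm, hxm']
  field_simp
  ring

lemma c2_eq (k : ℕ) : c2 k = 1 / c1 k := by rw [c1, c2, one_div_div]

/-- `a2 k` is not the reflection of `a1 k` but lies beyond it, so results up to `a1 k` still cover m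
≥ `a2 k`. -/
lemma one_div_a1_lt_a2 {k : ℕ} (hk : 1 ≤ k) : 1 / a1 k < a2 k := by
  have hk' : (0 : ℝ) < k := by exact_mod_cast hk
  have h : a1 k = (8 * (k : ℝ) ^ 3 + 24 * k ^ 2 + 20 * k + 3) /
      ((3 + 2 * k) * (4 * (k : ℝ) ^ 2 + 10 * k + 5)) := by
    rw [a1, c1, show 15 + 40 * (k : ℝ) + 32 * (k : ℝ) ^ 2 + 8 * (k : ℝ) ^ 3 =
      (3 + 2 * k) * (4 * (k : ℝ) ^ 2 + 10 * k + 5) by ring]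
    field_simp
    ring
  have h' : a2 k = ((3 + 2 * k) * (1 + 8 * k * (1 + (k : ℝ) ^ 2)) + 2 * (1 + 2 * k)) /
      ((1 + 2 * k) * (1 + 8 * k * (1 + (k : ℝ) ^ 2))) := by
    rw [a2, c2]
    field_simp
  rw [h, h', one_div_div, div_lt_div_iff₀ (by positivity) (by positivity), ← sub_pos]
  ring_nf
  positivity

lemma a1_pos (k : ℕ) : 0 < a1 k := lt_of_le_of_lt (by positivity) (lt_a1 (k := k))

lemma hyperbola_one_div {m : ℝ} (hm : 1 < m) :
    m * (π * (1 / m) / (1 - 1 / m)) = π * m / (m - 1) := by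
  have h1 : m - 1 ≠ 0 := by linarith
  have h2 : m ≠ 0 := by linarith
  have h3 : 1 - 1 / m = (m - 1) / m := by field_simp
  rw [h3]
  field_simp

lemma p2_lt_hyperbola_iff_one_div {m : ℝ} (hm : 1 < m) :
    p2 m < π * m / (m - 1) ↔ p2 (1 / m) < π * (1 / m) / (1 - 1 / m) := by
  rw [← hyperbola_one_div hm, p2_eq_of_one_lt hm, mul_lt_mul_iff_right₀ (by linarith)]

lemma hyperbola_lt_p2_iff_one_div {m : ℝ} (hm : 1 < m) :
    π * m / (m - 1) < p2 m ↔ π * (1 / m) / (1 - 1 / m) < p2 (1 / m) := by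
  rw [← hyperbola_one_div hm, p2_eq_of_one_lt hm, mul_lt_mul_iff_right₀ (by linarith)]

lemma one_lt_c2 (k : ℕ) : 1 < c2 k := by
  rw [c2_eq]
  exact one_lt_one_div (c1_mem k).1 (c1_lt_one k)

lemma c2_lt_a2 (k : ℕ) : c2 k < a2 k := by
  rw [a2]
  have : 0 < 2 / (1 + 8 * (k : ℝ) * (1 + (k : ℝ) ^ 2)) := by positivity
  linarith

lemma one_lt_add_two_div (k : ℕ) : 1 < ((k : ℝ) + 2) / (k + 1) := by
  rw [one_lt_div (by positivity)]
  linarith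

lemma one_div_le_c1_iff {k : ℕ} {m : ℝ} (hm : 1 < m) : c1 k ≤ 1 / m ↔ m ≤ c2 k := by
  rw [c2_eq, le_div_iff₀ (by linarith), le_div_iff₀ (c1_mem k).1, mul_comm]

lemma one_div_le_a1 {k : ℕ} (hk : 1 ≤ k) {m : ℝ} (hm : a2 k ≤ m) : 1 / m ≤ a1 k := by
  have h := (one_div_a1_lt_a2 hk).trans_le hm
  rw [div_lt_iff₀ (a1_pos k)] at h
  rw [div_le_iff₀ (lt_trans (by linarith [one_lt_c2 k]) ((c2_lt_a2 k).trans_le hm))]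
  linarith

lemma contDiffAt_p2_of_mem_of_one_lt {k : ℕ} (hk : 1 ≤ k) {m : ℝ}
    (h : m ∈ Icc (((k : ℝ) + 2) / (k + 1)) (c2 k) ∪ Icc (a2 k) (((k : ℝ) + 1) / k)) :
    ContDiffAt ℝ 1 p2 m := by
  have hk' : (0 : ℝ) < k := by exact_mod_cast hk
  rcases h with h | h
  · have hm : 1 < m := (one_lt_add_two_div k).trans_le h.1
    refine contDiffAt_p2_of_one_div hm (contDiffAt_p2_of_mem hk (Or.inr ?_))
    refine ⟨(one_div_le_c1_iff hm).2 h.2, ?_⟩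
    have := h.1
    rw [div_le_iff₀ (by positivity)] at this
    rw [div_le_div_iff₀ (by linarith) (by positivity)]
    linarith
  · have hm : 1 < m := (one_lt_c2 k).trans ((c2_lt_a2 k).trans_le h.1)
    refine contDiffAt_p2_of_one_div hm (contDiffAt_p2_of_mem hk (Or.inl ?_))
    refine ⟨?_, one_div_le_a1 hk h.1⟩
    have := h.2
    rw [le_div_iff₀ hk'] at this
    rw [div_le_div_iff₀ (by positivity) (by linarith)]
    linarith

lemma exists_mstar_mbar_of_one_lt {k : ℕ} (hk : 1 ≤ k) : ∃ mstar mbar : ℝ,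
    c2 k < mbar ∧ mbar < mstar ∧ mstar < a2 k ∧ p2 mstar = π * mstar / (mstar - 1) ∧
    DerivEqBot p2 mbar := by
  obtain ⟨ms, mb, h1, h2, h3, h4, h5⟩ := exists_mstar_mbar hk
  have hs : 0 < ms := (a1_pos k).trans h1
  have hb : 0 < mb := hs.trans h2
  have hb1 : mb < 1 := h3.trans (c1_lt_one k)
  have hs1 : 1 < 1 / ms := one_lt_one_div hs (h2.trans hb1)
  refine ⟨1 / ms, 1 / mb, ?_, one_div_lt_one_div_of_lt hs h2,
    (one_div_lt_one_div_of_lt (a1_pos k) h1).trans (one_div_a1_lt_a2 hk), ?_,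
    derivEqBot_of_one_div (one_lt_one_div hb hb1) (by rwa [one_div_one_div])⟩
  · rw [c2_eq]
    exact one_div_lt_one_div_of_lt hb h3
  · rw [p2_eq_of_one_lt hs1, ← hyperbola_one_div hs1, one_div_one_div, h4]

lemma p2_bounds_of_one_lt {m : ℝ} (h1 : 1 < m) (h2 : m ≤ 2) :
    π * m / (m - 1) - m / (m - 1) * arcsin ((m - 1) / (m + 1)) < p2 m ∧
      p2 m < π * m / (m - 1) + m / (3 - m) := by
  have hm0 : 0 < m := by linarith
  have hm1 : m - 1 ≠ 0 := by linarith
  have hm3 : 3 - m ≠ 0 := by linarith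
  obtain ⟨h3, h4⟩ := p2_bounds (m := 1 / m)
    (one_div_le_one_div_of_le hm0 h2) (one_div_mem h1).2
  have e1 : (1 - 1 / m) / (1 + 1 / m) = (m - 1) / (m + 1) := by
    field_simp
  have e2 : 1 - 1 / m = (m - 1) / m := by field_simp
  have e3 : 3 * (1 / m) - 1 = (3 - m) / m := by field_simp
  rw [p2_eq_of_one_lt h1]
  constructor
  · refine lt_of_eq_of_lt ?_ (mul_lt_mul_of_pos_left h3 hm0)
    rw [e1, e2]
    field_simp
  · refine (mul_lt_mul_of_pos_left h4 hm0).trans_eq ?_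
    rw [e2, e3]
    field_simp

lemma p2_bounds_of_two_lt {m : ℝ} (hm : 2 < m) : 5.7 < p2 m ∧ p2 m < 2 * π := by
  have hm0 : 0 < m := by linarith
  have h1 : 1 / m < 1 / 2 := one_div_lt_one_div_of_lt (by norm_num) hm
  have h2 := mul_lt_mul_of_pos_left (mul_lt_p2 (one_div_pos.2 hm0) h1) hm0
  have h3 := mul_lt_mul_of_pos_left (p2_lt_two_pi_mul (one_div_pos.2 hm0) h1) hm0
  rw [p2_eq_of_one_lt (by linarith)]
  constructor
  · refine lt_of_eq_of_lt ?_ h2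
    field_simp
  · refine h3.trans_eq ?_
    field_simp

end PlateBall

end

/-! ### Assembly of the theorem -/

theorem theorem2 :
    -- existence of the minimal positive root, and the functional equation
    (∀ m ∈ PlateBall.params, IsLeast (PlateBall.posRoots m) (PlateBall.p2 m)) ∧
    (∀ m ∈ PlateBall.params, PlateBall.p2 m = m * PlateBall.p2 (1 / m)) ∧
    -- (a) continuity and the values at `k/(k+1)` and `(k+1)/k`
    ContinuousOn PlateBall.p2 (Set.Ioo 0 1) ∧
    ContinuousOn PlateBall.p2 (Set.Ioi 1) ∧
    (∀ k : ℕ, 1 ≤ k → ∀ m : ℝ, m = (k : ℝ) / ((k : ℝ) + 1) →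
      PlateBall.p2 m = Real.pi * m / (1 - m)) ∧
    (∀ k : ℕ, 1 ≤ k → ∀ m : ℝ, m = ((k : ℝ) + 1) / (k : ℝ) →
      PlateBall.p2 m = Real.pi * m / (m - 1)) ∧
    -- (a), (b) the points `m*` (on the hyperbola) and `m̄` (infinite derivative)
    (∀ k : ℕ, 1 ≤ k → ∃ mstar mbar : ℝ,
      PlateBall.a1 k < mstar ∧ mstar < mbar ∧ mbar < PlateBall.c1 k ∧
      PlateBall.p2 mstar = Real.pi * mstar / (1 - mstar) ∧
      PlateBall.DerivEqTop PlateBall.p2 mbar) ∧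
    (∀ k : ℕ, 1 ≤ k → ∃ mstar mbar : ℝ,
      PlateBall.c2 k < mbar ∧ mbar < mstar ∧ mstar < PlateBall.a2 k ∧
      PlateBall.p2 mstar = Real.pi * mstar / (mstar - 1) ∧
      PlateBall.DerivEqBot PlateBall.p2 mbar) ∧
    -- (b) continuous differentiability
    (∀ m ∈ Set.Ioo (0 : ℝ) (1 / 2) ∪ Set.Ioi 2, ContDiffAt ℝ 1 PlateBall.p2 m) ∧
    (∀ k : ℕ, 1 ≤ k → ∀ m ∈
      Set.Icc ((k : ℝ) / (1 + (k : ℝ))) (PlateBall.a1 k) ∪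
      Set.Icc (PlateBall.c1 k) ((1 + (k : ℝ)) / (2 + (k : ℝ))) ∪
      Set.Icc (((k : ℝ) + 2) / ((k : ℝ) + 1)) (PlateBall.c2 k) ∪
      Set.Icc (PlateBall.a2 k) (((k : ℝ) + 1) / (k : ℝ)),
      ContDiffAt ℝ 1 PlateBall.p2 m) ∧
    -- (c) two-sided bounds
    (∀ m : ℝ, 0 < m → m < 1 / 2 →
      5.7 * m < PlateBall.p2 m ∧ PlateBall.p2 m < 2 * Real.pi * m) ∧
    (∀ m : ℝ, 1 / 2 ≤ m → m < 1 →
      Real.pi * m / (1 - m) - m / (1 - m) * Real.arcsin ((1 - m) / (1 + m)) < PlateBall.p2 m ∧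
      PlateBall.p2 m < Real.pi * m / (1 - m) + m / (3 * m - 1)) ∧
    (∀ m : ℝ, 1 < m → m ≤ 2 →
      Real.pi * m / (m - 1) - m / (m - 1) * Real.arcsin ((m - 1) / (m + 1)) < PlateBall.p2 m ∧
      PlateBall.p2 m < Real.pi * m / (m - 1) + m / (3 - m)) ∧
    (∀ m : ℝ, 2 < m → 5.7 < PlateBall.p2 m ∧ PlateBall.p2 m < 2 * Real.pi) ∧
    -- (d) position with respect to the hyperbola
    (∀ k : ℕ, 1 ≤ k →
      (∀ m ∈ Set.Ioc ((k : ℝ) / (1 + (k : ℝ))) (PlateBall.a1 k),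
        PlateBall.p2 m < Real.pi * m / (1 - m)) ∧
      (∀ m ∈ Set.Ico (PlateBall.c1 k) ((1 + (k : ℝ)) / (2 + (k : ℝ))),
        Real.pi * m / (1 - m) < PlateBall.p2 m) ∧
      (∀ m ∈ Set.Ioc (((k : ℝ) + 2) / ((k : ℝ) + 1)) (PlateBall.c2 k),
        Real.pi * m / (m - 1) < PlateBall.p2 m) ∧
      (∀ m ∈ Set.Ico (PlateBall.a2 k) (((k : ℝ) + 1) / (k : ℝ)),
        PlateBall.p2 m < Real.pi * m / (m - 1))) ∧
    -- (e) change of sign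
    (∀ m ∈ PlateBall.params,
      PlateBall.ChangesSignAt (fun p => PlateBall.g2 p m) (PlateBall.p2 m)) := by
  open PlateBall in
  refine ⟨fun m hm => ?_, fun m hm => p2_eq_mul_p2_one_div hm,
    fun m hm => (continuousAt_p2 hm).continuousWithinAt,
    fun m hm => (continuousAt_p2_of_one_lt hm).continuousWithinAt, ?_, ?_,
    fun k hk => exists_mstar_mbar hk, fun k hk => exists_mstar_mbar_of_one_lt hk, ?_, ?_,
    fun m h0 h => ⟨mul_lt_p2 h0 h, p2_lt_two_pi_mul h0 h⟩, fun m h0 h => p2_bounds h0 h,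
    fun m h0 h => p2_bounds_of_one_lt h0 h, fun m h => p2_bounds_of_two_lt h, ?_, ?_⟩
  · rcases hm with hm | hm
    · exact isLeast_p2 hm
    · rw [p2_eq_of_one_lt hm]
      exact isLeast_posRoots_of_one_lt hm
  · rintro k hk m rfl
    have h : 1 - (k : ℝ) / (k + 1) = 1 / (k + 1) := by
      field_simp
      ring
    rw [p2_div_add_one hk, h]
    field_simp
  · rintro k hk m rfl
    have hk' : (0 : ℝ) < k := by exact_mod_cast hk
    have h : ((k : ℝ) + 1) / k - 1 = 1 / k := by
      field_simp
      ring
    rw [p2_eq_of_one_lt ((one_lt_div hk').2 (by linarith)), one_div_div, p2_div_add_one hk, h]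
    field_simp
  · rintro m (hm | hm)
    · exact contDiffAt_p2_of_lt_half hm.1 hm.2
    · have hm' : (2 : ℝ) < m := hm
      exact contDiffAt_p2_of_one_div (by linarith) (contDiffAt_p2_of_lt_half
        (by positivity) (one_div_lt_one_div_of_lt (by norm_num) hm'))
  · rintro k hk m (((h | h) | h) | h)
    · exact contDiffAt_p2_of_mem hk (Or.inl h)
    · exact contDiffAt_p2_of_mem hk (Or.inr h)
    · exact contDiffAt_p2_of_mem_of_one_lt hk (Or.inl h)
    · exact contDiffAt_p2_of_mem_of_one_lt hk (Or.inr h)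
  · intro k hk
    have hk' : (0 : ℝ) < k := by exact_mod_cast hk
    refine ⟨fun m hm => p2_lt_hyperbola hk hm.1 hm.2, fun m hm => hyperbola_lt_p2 hm.1 hm.2,
      fun m hm => ?_, fun m hm => ?_⟩
    · have hm1 : 1 < m := (one_lt_add_two_div k).trans hm.1
      refine (hyperbola_lt_p2_iff_one_div hm1).2
        (hyperbola_lt_p2 ((one_div_le_c1_iff hm1).2 hm.2) ?_)
      have := hm.1
      rw [div_lt_iff₀ (by positivity)] at this
      rw [div_lt_div_iff₀ (by linarith) (by positivity)]
      linarith
    · have hm1 : 1 < m := (one_lt_c2 k).trans ((c2_lt_a2 k).trans_le hm.1)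
      refine (p2_lt_hyperbola_iff_one_div hm1).2 (p2_lt_hyperbola hk ?_ (one_div_le_a1 hk hm.1))
      have := hm.2
      rw [lt_div_iff₀ hk'] at this
      rw [div_lt_div_iff₀ (by positivity) (by linarith)]
      linarith
  · rintro m (hm | hm)
    · exact Or.inl (changesSignAt_p2 hm)
    · exact changesSignAt_of_one_lt hm
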